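/- Let $n\ge 2$ and let $\Omega\subset\mathbb R^n$ be a bounded domain with Lipschitz boundary (i.e. $\Omega$ is nonempty, open, connected and bounded, and near each boundary point a bi-Lipschitz change of coordinates flattens $\partial\Omega$, with $\Omega$ on exactly one side). Let $\mathcal E_1,\dots,\mathcal E_m\subset\partial\Omega$ be pairwise disjoint measurable electrodes of positive surface measure, and let $(j_r,k_r)$, $r=1,\dots,N$, be pairs of electrode indices with $j_r\ne k_r$. All function spaces are complex-valued. For $\gamma\in L^\infty_+(\Omega;\mathbb R)+\mathrm iL^\infty(\Omega;\mathbb R)$ (bounded measurable, real part with positive essential infimum) let $u^{\langle r\rangle}_\gamma\in H^1(\Omega)$ be the weak solution of the shunt model $$\nabla\cdot(\gamma\nabla u)=0\ \text{in }\Omega,\quad \int_{\mathcal E_l}\gamma\,\partial_\nu u\,ds=\delta_{l,j_r}-\delta_{l,k_r},\quad \gamma\,\partial_\nu u=0\ \text{on }\partial\Omega\setminus\bigcup_l\mathcal E_l,\quad u|_{\mathcal E_l}=\text{const.}\ (l=1,\dots,m),$$ where the constants $u|_{\mathcal E_l}$ sum up to zero; that is, $\int_\Omega\gamma\nabla u\cdot\overline{\nabla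 v}\,dx=\sum_l(\delta_{l,j_r}-\delta_{l,k_r})\overline{v|_{\mathcal E_l}}$ for all $v\in H^1(\Omega)$ that are constant on each electrode. The measurement matrix is $$R(\gamma)=\Big(u^{\langle r\rangle}_\gamma|_{\mathcal E_{j_s}}-u^{\langle r\rangle}_\gamma|_{\mathcal E_{k_s}}\Big)_{r,s=1}^N\in\mathbb C^{N\times N}.$$ For a square matrix $A$ put $\operatorname{Re}(A)=\frac12(A+A^*)$; for self-adjoint $A,B$ write $A\le B$ if $B-A$ is positive semidefinite. Let $D\subset\Omega$ be a closed set such that $\Omega\setminus D$ is connected, let $\omega,\sigma_\Omega,\sigma_D,\epsilon_\Omega,\epsilon_D>0$, and let $\gamma_0=\sigma_D$, $\gamma_\omega=\sigma_D+\mathrm i\omega\epsilon_D$ on $D$ and $\gamma_0=\sigma_\Omega$, $\gamma_\omega=\sigma_\Omega+\mathrm i\omega\epsilon_\Omega$ on $\Omega\setminus D$. Put $\alpha=1+\mathrm i\omega\epsilon_\Omega/\sigma_\Omega$ and $c=\epsilon_D\sigma_\Omega-\epsilon_\Omega\sigma_D$. **Theorem.** For every admittivity $\gamma$ as above and every $r$,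 the shunt model has exactly one solution, so that $R(\gamma)$ is well defined; and the admittivities $\gamma_\omega$, $(1\pm\beta\chi_B)\gamma_0$ below are of this class. Moreover: (a) If $c>0$, then for every $0<\beta\le\omega^2|c|\dfrac{\epsilon_\Omega}{\sigma_D(\sigma_\Omega^2+\omega^2\epsilon_\Omega^2)}$ and every open set $B\subseteq\Omega$, $$B\subseteq D\quad\text{implies}\quad \operatorname{Re}(\alpha R(\gamma_\omega))\le R((1+\beta\chi_B)\gamma_0).$$ (b) If $c<0$, then for every $0<\beta\le\omega^2|c|\dfrac{\epsilon_D}{\sigma_D(\sigma_D\sigma_\Omega+\omega^2\epsilon_D\epsilon_\Omega)}$ and every open set $B\subseteq\Omega$, $$B\subseteq D\quad\text{implies}\quad \operatorname{Re}(\alpha R(\gamma_\omega))\ge R((1-\beta\chi_B)\gamma_0).$$ -/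

import Mathlib

open MeasureTheory Filter Topology
open scoped ComplexOrder

noncomputable section

namespace EIT

/-- A bounded domain (nonempty, open, connected) in `ℝⁿ` with Lipschitz boundary: near each of its
boundary points, a bi-Lipschitz change of coordinates flattens the boundary, with the domain lying
on exactly one side of it. -/
def IsLipschitzDomain {n : ℕ} (Ω : Set (EuclideanSpace ℝ (Fin n))) : Prop :=
  IsOpen Ω ∧ IsConnected Ω ∧ Bornology.IsBounded Ω ∧
    ∀ x ∈ frontier Ω, ∃ (i : Fin n) (K : NNReal)
      (e : OpenPartialHomeomorph (EuclideanSpace ℝ (Fin n)) (EuclideanSpace ℝ (Fin n))),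
      x ∈ e.source ∧ LipschitzOnWith K e e.source ∧ LipschitzOnWith K e.symm e.target ∧
        ∀ z ∈ e.source, z ∈ Ω ↔ 0 < e z i

/-- The surface measure on the boundary of `Ω`, i.e. the (normalized) `(n-1)`-dimensional Hausdorff
measure restricted to the boundary. -/
def surfaceMeasure {n : ℕ} (Ω : Set (EuclideanSpace ℝ (Fin n))) :
    Measure (EuclideanSpace ℝ (Fin n)) :=
  (Measure.euclideanHausdorffMeasure (n - 1)).restrict (frontier Ω)

/-- The classical gradient of a complex-valued function on `ℝⁿ`. -/
def classicalGrad {n : ℕ} (φ : EuclideanSpace ℝ (Fin n) → ℂ) (x : EuclideanSpace ℝ (Fin n)) :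
    EuclideanSpace ℂ (Fin n) :=
  WithLp.toLp 2 fun i => fderiv ℝ φ x (EuclideanSpace.single i 1)

/-- `u ∈ H¹(Ω)` with weak gradient `G`: both are square integrable on `Ω`, and integration by parts
holds against all real test functions in `C_c^∞(Ω)`. -/
def MemH1 {n : ℕ} (Ω : Set (EuclideanSpace ℝ (Fin n))) (u : EuclideanSpace ℝ (Fin n) → ℂ)
    (G : EuclideanSpace ℝ (Fin n) → EuclideanSpace ℂ (Fin n)) : Prop :=
  MemLp u 2 (volume.restrict Ω) ∧ MemLp G 2 (volume.restrict Ω) ∧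
    ∀ φ : EuclideanSpace ℝ (Fin n) → ℝ, ContDiff ℝ ((⊤ : ℕ∞) : WithTop ℕ∞) φ → HasCompactSupport φ → tsupport φ ⊆ Ω →
      ∀ i : Fin n,
        ∫ x in Ω, u x * ((fderiv ℝ φ x (EuclideanSpace.single i 1) : ℝ) : ℂ) =
          - ∫ x in Ω, G x i * ((φ x : ℝ) : ℂ)

/-- `g` is the boundary trace of the `H¹(Ω)`-function `u` with weak gradient `G`. The trace
operator is the continuous extension of the restriction map `φ ↦ φ|_{∂Ω}`, from smooth functions
to `H¹(Ω) → L²(∂Ω)`; so `g` is the trace of `u` iff some smooth functions converge to `u` in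
`H¹(Ω)` while their boundary values converge to `g` in `L²(∂Ω)`. -/
def HasTrace {n : ℕ} (Ω : Set (EuclideanSpace ℝ (Fin n))) (u : EuclideanSpace ℝ (Fin n) → ℂ)
    (G : EuclideanSpace ℝ (Fin n) → EuclideanSpace ℂ (Fin n))
    (g : EuclideanSpace ℝ (Fin n) → ℂ) : Prop :=
  MemLp g 2 (surfaceMeasure Ω) ∧
    ∃ φ : ℕ → EuclideanSpace ℝ (Fin n) → ℂ, (∀ k, ContDiff ℝ ((⊤ : ℕ∞) : WithTop ℕ∞) (φ k)) ∧
      Tendsto (fun k => eLpNorm (fun x => φ k x - u x) 2 (volume.restrict Ω)) atTop (𝓝 0) ∧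
      Tendsto (fun k => eLpNorm (fun x => classicalGrad (φ k) x - G x) 2 (volume.restrict Ω))
        atTop (𝓝 0) ∧
      Tendsto (fun k => eLpNorm (fun x => φ k x - g x) 2 (surfaceMeasure Ω)) atTop (𝓝 0)

/-- `u ∈ H¹(Ω)`, with weak gradient `G`, is constant on each electrode `E l`, with value `U l`
there, in the sense of traces. -/
def MemH1Electrode {n m : ℕ} (Ω : Set (EuclideanSpace ℝ (Fin n)))
    (E : Fin m → Set (EuclideanSpace ℝ (Fin n))) (u : EuclideanSpace ℝ (Fin n) → ℂ)
    (G : EuclideanSpace ℝ (Fin n) → EuclideanSpace ℂ (Fin n)) (U : Fin m → ℂ) : Prop :=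
  MemH1 Ω u G ∧ ∃ g : EuclideanSpace ℝ (Fin n) → ℂ, HasTrace Ω u G g ∧
    ∀ l, ∀ᵐ x ∂((surfaceMeasure Ω).restrict (E l)), g x = U l

/-- Complex admittivities `γ ∈ L^∞_+(Ω; ℝ) + i L^∞(Ω; ℝ)`. -/
def IsAdmittivity {n : ℕ} (Ω : Set (EuclideanSpace ℝ (Fin n)))
    (γ : EuclideanSpace ℝ (Fin n) → ℂ) : Prop :=
  AEStronglyMeasurable γ (volume.restrict Ω) ∧
    (∃ M : ℝ, ∀ᵐ x ∂(volume.restrict Ω), ‖γ x‖ ≤ M) ∧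
    ∃ κ : ℝ, 0 < κ ∧ ∀ᵐ x ∂(volume.restrict Ω), κ ≤ (γ x).re

/-- `u` solves the shunt model with admittivity `γ` and electrode currents `I`, and `U l` is its
constant value on the electrode `E l`; the values `U l` sum up to zero. The equations
`∇·(γ∇u) = 0` in `Ω`, `∫_{E l} γ ∂_ν u = I l` and `γ ∂_ν u = 0` off the electrodes are meant in the
usual weak sense: Green's formula
`∫_Ω γ ∇u · conj ∇v = ∫_{∂Ω} γ ∂_ν u · conj v = ∑_l I_l conj V_l`
holds for all `v ∈ H¹(Ω)` which are constant on each electrode, `v = V l` on `E l`. -/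
def IsShuntSolution {n m : ℕ} (Ω : Set (EuclideanSpace ℝ (Fin n)))
    (E : Fin m → Set (EuclideanSpace ℝ (Fin n))) (γ : EuclideanSpace ℝ (Fin n) → ℂ)
    (I : Fin m → ℂ) (u : EuclideanSpace ℝ (Fin n) → ℂ) (U : Fin m → ℂ) : Prop :=
  ∃ G : EuclideanSpace ℝ (Fin n) → EuclideanSpace ℂ (Fin n),
    MemH1Electrode Ω E u G U ∧ ∑ l, U l = 0 ∧
      ∀ (v : EuclideanSpace ℝ (Fin n) → ℂ)
        (H : EuclideanSpace ℝ (Fin n) → EuclideanSpace ℂ (Fin n)) (V : Fin m → ℂ),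
        MemH1Electrode Ω E v H V →
          ∫ x in Ω, γ x * ∑ i, G x i * (starRingEnd ℂ) (H x i) =
            ∑ l, I l * (starRingEnd ℂ) (V l)

/-- The shunt model with admittivity `γ` and currents `I` has exactly one solution (the potential
being unique up to equality almost everywhere in `Ω`). -/
def ShuntWellPosed {n m : ℕ} (Ω : Set (EuclideanSpace ℝ (Fin n)))
    (E : Fin m → Set (EuclideanSpace ℝ (Fin n))) (γ : EuclideanSpace ℝ (Fin n) → ℂ)
    (I : Fin m → ℂ) : Prop :=
  ∃ (u : EuclideanSpace ℝ (Fin n) → ℂ) (U : Fin m → ℂ), IsShuntSolution Ω E γ I u U ∧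
    ∀ (u' : EuclideanSpace ℝ (Fin n) → ℂ) (U' : Fin m → ℂ), IsShuntSolution Ω E γ I u' U' →
      u' =ᵐ[volume.restrict Ω] u ∧ U' = U

open Classical in
/-- The constant values on the electrodes of the solution of the shunt model
(`0` if there is no solution). -/
def electrodeVoltages {n m : ℕ} (Ω : Set (EuclideanSpace ℝ (Fin n)))
    (E : Fin m → Set (EuclideanSpace ℝ (Fin n))) (γ : EuclideanSpace ℝ (Fin n) → ℂ)
    (I : Fin m → ℂ) : Fin m → ℂ :=
  if h : ∃ (U : Fin m → ℂ) (u : EuclideanSpace ℝ (Fin n) → ℂ), IsShuntSolution Ω E γ I u U then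
    h.choose
  else 0

/-- The dipole current pattern `I_l = δ_{l,a} - δ_{l,b}`. -/
def dipole {m : ℕ} (a b : Fin m) : Fin m → ℂ :=
  fun l => (if l = a then 1 else 0) - (if l = b then 1 else 0)

/-- The measurement matrix `R(γ)` of the dipole-dipole configuration `(j r, k r)`, `r = 1, …, N`:
the `(r, s)` entry is the voltage between the electrodes `j s` and `k s` when the current is driven
through the pair `(j r, k r)`. -/
def measurementMatrix {n m N : ℕ} (Ω : Set (EuclideanSpace ℝ (Fin n)))
    (E : Fin m → Set (EuclideanSpace ℝ (Fin n))) (j k : Fin N → Fin m)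
    (γ : EuclideanSpace ℝ (Fin n) → ℂ) : Matrix (Fin N) (Fin N) ℂ :=
  Matrix.of fun r s =>
    electrodeVoltages Ω E γ (dipole (j r) (k r)) (j s) -
      electrodeVoltages Ω E γ (dipole (j r) (k r)) (k s)

/-- The self-adjoint part `(A + A*) / 2` of a matrix. -/
def selfAdjPart {N : ℕ} (A : Matrix (Fin N) (Fin N) ℂ) : Matrix (Fin N) (Fin N) ℂ :=
  (1 / 2 : ℂ) • (A + A.conjTranspose)

open Classical in
/-- The admittivity with the constant value `a` in the inclusion `D` and `b` outside of it. -/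
def twoPhase {n : ℕ} (D : Set (EuclideanSpace ℝ (Fin n))) (a b : ℂ) :
    EuclideanSpace ℝ (Fin n) → ℂ :=
  fun x => if x ∈ D then a else b

/-- The ultrasound-modulated admittivity `(1 + β χ_B) γ`. -/
def modulated {n : ℕ} (β : ℝ) (B : Set (EuclideanSpace ℝ (Fin n)))
    (γ : EuclideanSpace ℝ (Fin n) → ℂ) : EuclideanSpace ℝ (Fin n) → ℂ :=
  fun x => (1 + (β : ℂ) * B.indicator (fun _ => (1 : ℂ)) x) * γ x

end EIT

end

noncomputable section

namespace EIT

/-! Division of the admittivity by `α` multiplies potentials by `α`, so `α R(γω) = R(γω / α)`, and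
`γω / α` equals the real background `σΩ` off `D`. For `z ∈ ℂᴺ` the real part of `z* R z` is the real
power `∑ J_l conj U_l` of the potential driven by the superposed current `J = ∑ conj(z_r) dipole_r`.
Both parts thus compare the powers `P_γ` and `P_g` of a complex `γ` and a real `g` under one
current.

Write `a`, `b` for the gradients of the two potentials. If `g ≤ Re γ`, then pointwise `2 g Re(b ·
conj a) ≤ g |b|² + Re γ |a|²`; integrating and inserting the potentials as test functions gives `2
P_γ ≤ P_g + P_γ`. If `|γ|² ≤ g Re γ`, then `2 Re(γ a · conj b) ≤ g |b|² + Re γ |a|²` gives `2 P_g ≤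
P_g + P_γ`. These are `re_power_le_of_le_re` and `re_power_le_of_norm_sq_le`. For `γ = γω / α` the
pointwise hypotheses on `B` are exactly the two bounds on `β` (`one_add_mul_le_of_le`,
`le_one_sub_mul_of_le`); off `D` they are equalities.

Most of the file is well-posedness. Potentials are modelled as triples (function, gradient, trace)
in the closure `traceGraph` of the smooth functions, and Lax-Milgram is applied on the closed
subspace with constant electrode values of sum zero. Coercivity there (`exists_norm_le_norm_grad`)
needs the Poincaré and trace inequalities on a domain with bi-Lipschitz charts. Both are proved for
`C¹` functions: on half balls by integrating along segments, on charts by comparing measures under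
Lipschitz maps, and on the domain by connectedness and compactness. -/

/-! ### `C¹` functions along Lipschitz curves. -/

open Set in
theorem norm_comp_sub_le_integral_fderiv {F : Type*} [NormedAddCommGroup F] [NormedSpace ℝ F]
    {φ : F → ℂ} (hφ : ContDiff ℝ 1 φ) {K : NNReal} {γ : ℝ → F} (hγ : LipschitzWith K γ)
    {a b : ℝ} (hab : a ≤ b) :
    ‖φ (γ b) - φ (γ a)‖ ≤ ∫ t in a..b, K * ‖fderiv ℝ φ (γ t)‖ := by
  have hcont : Continuous fun t => K * ‖fderiv ℝ φ (γ t)‖ :=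
    continuous_const.mul (((hφ.continuous_fderiv one_ne_zero).comp hγ.continuous).norm)
  refine le_of_forall_pos_le_add fun ε hε => ?_
  -- The `+ 1` keeps the denominator positive when `a = b`.
  have hε' : 0 < ε / (b - a + 1) := div_pos hε (by linarith)
  set δ := ε / (b - a + 1) with hδ
  -- The curve need not be differentiable, so the norm of the increment is fenced in by a primitive
  -- of the speed bound. The slope `δ` supplies the strict inequality that fencing requires.
  have key := image_norm_le_of_liminf_right_slope_norm_lt_deriv_boundary
    (f := fun t => φ (γ t) - φ (γ a)) (a := a) (b := b)
    (f' := fun t => K * ‖fderiv ℝ φ (γ t)‖)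
    (B := fun t => (∫ s in a..t, K * ‖fderiv ℝ φ (γ s)‖) + δ * (t - a))
    (B' := fun t => K * ‖fderiv ℝ φ (γ t)‖ + δ)
    ((hφ.continuous.comp hγ.continuous).sub continuous_const).continuousOn
    ?_ (by simp) ?_ ?_ (fun x _ _ => by linarith) (right_mem_Icc.2 hab)
  · refine key.trans ?_
    have : δ * (b - a) ≤ ε := by
      rw [hδ, div_mul_eq_mul_div, div_le_iff₀ (by linarith)]; nlinarith
    simpa using this
  · intro x _ r hr
    -- Near `γ x` the function `φ` is `L`-Lipschitz for every `L` above the norm of its derivative,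
    -- so right slopes are at most `K * L < r`.
    obtain ⟨L, hL, hLr⟩ : ∃ L : NNReal, ‖fderiv ℝ φ (γ x)‖₊ < L ∧ K * L < r := by
      have hc : Tendsto (fun η : ℝ => (K : ℝ) * (‖fderiv ℝ φ (γ x)‖ + η)) (𝓝[>] 0)
          (𝓝 (K * (‖fderiv ℝ φ (γ x)‖ + 0))) :=
        ((continuous_const.mul (continuous_const.add continuous_id)).tendsto 0).mono_left
          nhdsWithin_le_nhds
      rw [add_zero] at hc
      obtain ⟨η, h1, h2⟩ := ((hc.eventually (gt_mem_nhds hr)).and self_mem_nhdsWithin).exists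
      have h2' : 0 < η := h2
      have h3 : 0 ≤ ‖fderiv ℝ φ (γ x)‖ + η := by positivity
      refine ⟨(‖fderiv ℝ φ (γ x)‖ + η).toNNReal, ?_, ?_⟩
      · rw [← NNReal.coe_lt_coe, Real.coe_toNNReal _ h3, coe_nnnorm]
        linarith
      · rwa [Real.coe_toNNReal _ h3]
    obtain ⟨s, hs, hLs⟩ := (hφ.contDiffAt.hasStrictFDerivAt
      one_ne_zero).exists_lipschitzOnWith_of_nnnorm_lt L hL
    have h1 : ∀ᶠ z in 𝓝[>] x, γ z ∈ s :=
      (hγ.continuous.continuousAt.eventually hs).filter_mono nhdsWithin_le_nhds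
    refine (Eventually.frequently ?_)
    filter_upwards [h1, self_mem_nhdsWithin] with z hz hxz
    have hxz' : 0 < z - x := sub_pos.2 hxz
    rw [slope_def_field, div_lt_iff₀ hxz']
    have h2 := hLs.dist_le_mul _ hz _ (mem_of_mem_nhds hs)
    have h3 := hγ.dist_le_mul z x
    rw [Real.dist_eq, abs_of_pos hxz'] at h3
    rw [dist_eq_norm] at h2
    have h4 : ‖φ (γ z) - φ (γ a)‖ - ‖φ (γ x) - φ (γ a)‖ ≤ ‖φ (γ z) - φ (γ x)‖ := by
      have := norm_sub_norm_le (φ (γ z) - φ (γ a)) (φ (γ x) - φ (γ a))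
      simpa using this
    calc _ ≤ ‖φ (γ z) - φ (γ x)‖ := h4
      _ ≤ L * dist (γ z) (γ x) := h2
      _ ≤ L * (K * (z - x)) := by gcongr
      _ = (K * L) * (z - x) := by ring
      _ < r * (z - x) := by gcongr
  · exact ((intervalIntegral.continuous_primitive (fun _ _ => hcont.intervalIntegrable _ _) a).add
      (continuous_const.mul (continuous_id.sub continuous_const))).continuousOn
  · intro x _
    have h1 := (hcont.integral_hasStrictDerivAt a x).hasDerivAt.add
      (((hasDerivAt_id x).sub_const a).const_mul δ)
    rw [mul_one] at h1
    exact h1.hasDerivWithinAt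

/-- Cauchy-Schwarz against the constant 1: expand the nonnegative integral of the squared deviation
of `g` from its mean. -/
theorem sq_integral_le_mul_integral_sq {g : ℝ → ℝ} (hg : Continuous g) {a b : ℝ} (hab : a ≤ b) :
    (∫ t in a..b, g t) ^ 2 ≤ (b - a) * ∫ t in a..b, g t ^ 2 := by
  rcases hab.eq_or_lt with rfl | hlt
  · simp
  have hL : 0 < b - a := sub_pos.2 hlt
  set M := ∫ t in a..b, g t
  have h0 : 0 ≤ ∫ t in a..b, (g t - M / (b - a)) ^ 2 :=
    intervalIntegral.integral_nonneg hab fun _ _ => sq_nonneg _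
  have h1 : ∫ t in a..b, (g t - M / (b - a)) ^ 2 =
      (∫ t in a..b, g t ^ 2) - 2 * (M / (b - a)) * M + (b - a) * (M / (b - a)) ^ 2 := by
    have : ∀ t, (g t - M / (b - a)) ^ 2 =
        g t ^ 2 - 2 * (M / (b - a)) * g t + (M / (b - a)) ^ 2 := fun t => by ring
    simp_rw [this]
    rw [intervalIntegral.integral_add, intervalIntegral.integral_sub,
      intervalIntegral.integral_const_mul, intervalIntegral.integral_const, smul_eq_mul]
    all_goals exact Continuous.intervalIntegrable (by fun_prop) _ _
  rw [h1] at h0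
  have h2 : (b - a) * (M / (b - a)) ^ 2 = M ^ 2 / (b - a) := by field_simp
  have h3 : 2 * (M / (b - a)) * M = 2 * (M ^ 2 / (b - a)) := by ring
  rw [h2, h3] at h0
  have h4 : M ^ 2 / (b - a) ≤ ∫ t in a..b, g t ^ 2 := by linarith
  rwa [div_le_iff₀ hL, mul_comm] at h4

open Set in
/-- A `C¹` function along a Lipschitz curve, in terms of its derivative along the curve. -/
theorem enorm_comp_sub_sq_le_lintegral {F : Type*} [NormedAddCommGroup F] [NormedSpace ℝ F]
    {φ : F → ℂ} (hφ : ContDiff ℝ 1 φ) {K : NNReal} {γ : ℝ → F} {a b : ℝ} (hab : a ≤ b)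
    (hγ : LipschitzOnWith K γ (Icc a b)) :
    ‖φ (γ a) - φ (γ b)‖ₑ ^ 2 ≤
      ENNReal.ofReal (K ^ 2 * (b - a)) * ∫⁻ t in Ioo a b, ‖fderiv ℝ φ (γ t)‖ₑ ^ 2 := by
  -- Clamping the parameter to `[a, b]` makes the curve Lipschitz on the whole line.
  set γ' : ℝ → F := fun t => γ (projIcc a b hab t) with hγ'
  have hL : LipschitzWith K γ' := by
    have h1 := (lipschitzOnWith_iff_restrict.1 hγ).comp (LipschitzWith.projIcc hab)
    rw [mul_one] at h1
    exact h1
  have heq : ∀ t ∈ Icc a b, γ' t = γ t := fun t ht => by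
    simp only [hγ', projIcc_of_mem hab ht]
  have hc : Continuous fun t => ‖fderiv ℝ φ (γ' t)‖ :=
    ((hφ.continuous_fderiv one_ne_zero).comp hL.continuous).norm
  have h1 := norm_comp_sub_le_integral_fderiv hφ hL hab
  have h2 : ‖φ (γ' b) - φ (γ' a)‖ ^ 2 ≤
      K ^ 2 * (b - a) * ∫ t in a..b, ‖fderiv ℝ φ (γ' t)‖ ^ 2 := by
    calc _ ≤ (∫ t in a..b, K * ‖fderiv ℝ φ (γ' t)‖) ^ 2 := by gcongr
      _ = K ^ 2 * (∫ t in a..b, ‖fderiv ℝ φ (γ' t)‖) ^ 2 := by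
        rw [intervalIntegral.integral_const_mul]; ring
      _ ≤ K ^ 2 * ((b - a) * ∫ t in a..b, ‖fderiv ℝ φ (γ' t)‖ ^ 2) := by
        gcongr; exact sq_integral_le_mul_integral_sq hc hab
      _ = _ := by ring
  rw [heq a (left_mem_Icc.2 hab), heq b (right_mem_Icc.2 hab), norm_sub_rev] at h2
  have h3 : ∫⁻ t in Ioo a b, ‖fderiv ℝ φ (γ t)‖ₑ ^ 2 =
      ENNReal.ofReal (∫ t in a..b, ‖fderiv ℝ φ (γ' t)‖ ^ 2) := by
    rw [intervalIntegral.integral_of_le hab, integral_Ioc_eq_integral_Ioo,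
      ofReal_integral_eq_lintegral_ofReal]
    · refine setLIntegral_congr_fun measurableSet_Ioo fun t ht => ?_
      simp only [heq t (Ioo_subset_Icc_self ht)]
      rw [ENNReal.ofReal_pow (norm_nonneg _), ofReal_norm]
    · exact ((hc.pow 2).integrableOn_Icc).mono_set Ioo_subset_Icc_self
    · exact Eventually.of_forall fun _ => sq_nonneg _
  rw [h3, ← ENNReal.ofReal_mul (mul_nonneg (sq_nonneg _) (sub_nonneg.2 hab)), ← ofReal_norm,
    ← ENNReal.ofReal_pow (norm_nonneg _)]
  exact ENNReal.ofReal_le_ofReal h2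

/-! ### Poincaré inequality on convex sets and their Lipschitz images. -/

section Convex

variable {W : Type*} [NormedAddCommGroup W] [NormedSpace ℝ W] [FiniteDimensional ℝ W]
  [MeasurableSpace W] [BorelSpace W] (μ : Measure W) [μ.IsAddHaarMeasure]

theorem lintegral_comp_smul_add {h : W → ENNReal} (hh : Measurable h) {s : ℝ} (hs : s ≠ 0)
    (w : W) : ∫⁻ x, h (s • x + w) ∂μ =
      ENNReal.ofReal |(s ^ Module.finrank ℝ W)⁻¹| * ∫⁻ x, h x ∂μ := by
  have h1 : Measurable fun z => h (z + w) := hh.comp (measurable_add_const w)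
  have h2 := lintegral_map (μ := μ) h1 (measurable_const_smul s)
  rw [Measure.map_addHaar_smul μ hs, lintegral_smul_measure, lintegral_add_right_eq_self] at h2
  exact h2.symm

theorem lintegral_comp_smul_add_le {h : W → ENNReal} (hh : Measurable h) {s : ℝ} (hs : 1 / 2 ≤ s)
    (w : W) : ∫⁻ x, h (s • x + w) ∂μ ≤ 2 ^ Module.finrank ℝ W * ∫⁻ x, h x ∂μ := by
  have hs0 : 0 < s := by linarith
  rw [lintegral_comp_smul_add μ hh hs0.ne']
  gcongr
  rw [abs_of_pos (by positivity), ← inv_pow]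
  refine (ENNReal.ofReal_le_ofReal (pow_le_pow_left₀ (by positivity)
    (inv_anti₀ (by norm_num) hs) _)).trans ?_
  rw [ENNReal.ofReal_pow (by norm_num)]
  norm_num

/-- One of the weights `1 - t`, `t` is at least `1/2`. Integrating first in the variable with that
weight, the Jacobian costs at most `2 ^ dim`, uniformly in `t`. -/
theorem lintegral_lintegral_convexComb_le {h : W → ENNReal} (hh : Measurable h) (c : Set W)
    [IsFiniteMeasure (μ.restrict c)] {t : ℝ} :
    ∫⁻ x in c, ∫⁻ y in c, h ((1 - t) • x + t • y) ∂μ ∂μ ≤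
      μ c * (2 ^ Module.finrank ℝ W * ∫⁻ x, h x ∂μ) := by
  rcases le_total t (1 / 2) with ht | ht
  · rw [lintegral_lintegral_swap]
    · calc _ ≤ ∫⁻ _ in c, 2 ^ Module.finrank ℝ W * ∫⁻ x, h x ∂μ ∂μ := by
            refine lintegral_mono fun y => ?_
            exact (setLIntegral_le_lintegral _ _).trans
              (lintegral_comp_smul_add_le μ hh (by linarith) _)
        _ = _ := by rw [setLIntegral_const, mul_comm]
    · refine (hh.comp (?_ : Measurable fun p : W × W => (1 - t) • p.1 + t • p.2)).aemeasurable
      fun_prop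
  · calc _ ≤ ∫⁻ _ in c, 2 ^ Module.finrank ℝ W * ∫⁻ x, h x ∂μ ∂μ := by
            refine lintegral_mono fun y => ?_
            refine (setLIntegral_le_lintegral _ _).trans ?_
            simp_rw [add_comm ((1 - t) • y)]
            exact lintegral_comp_smul_add_le μ hh ht _
        _ = _ := by rw [setLIntegral_const, mul_comm]

open Set in
/-- Poincaré inequality on a Lipschitz image of a bounded open convex set. -/
theorem lintegral_lintegral_comp_sub_sq_le {F : Type*} [NormedAddCommGroup F] [NormedSpace ℝ F]
    [MeasurableSpace F] [BorelSpace F]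
    {c : Set W} (hc : Convex ℝ c) (hco : IsOpen c) (hcb : Bornology.IsBounded c) {f : W → F}
    {K : NNReal} (hf : LipschitzOnWith K f c) :
    ∃ C : NNReal, ∀ φ : F → ℂ, ContDiff ℝ 1 φ →
      ∫⁻ x in c, ∫⁻ y in c, ‖φ (f x) - φ (f y)‖ₑ ^ 2 ∂μ ∂μ ≤
        C * ∫⁻ x in c, ‖fderiv ℝ φ (f x)‖ₑ ^ 2 ∂μ := by
  obtain ⟨R, hR⟩ := Metric.isBounded_iff.1 hcb
  have hfin : μ c ≠ ⊤ := hcb.measure_lt_top.ne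
  have : IsFiniteMeasure (μ.restrict c) := ⟨by simpa using hfin.lt_top⟩
  -- Segments in `c` have length at most `R`, so `f` along a segment parametrized by `[0, 1]` is
  -- `L`-Lipschitz.
  set L : NNReal := K * R.toNNReal with hL
  set A : ENNReal := ENNReal.ofReal ((L : ℝ) ^ 2 * (1 - 0)) with hA
  refine ⟨(A * (μ c * 2 ^ Module.finrank ℝ W)).toNNReal, fun φ hφ => ?_⟩
  rw [ENNReal.coe_toNNReal (ENNReal.mul_ne_top ENNReal.ofReal_ne_top
    (ENNReal.mul_ne_top hfin (by finiteness)))]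
  -- Extension by zero, so that affine changes of variables can be made on the whole space.
  set h : W → ENNReal := c.indicator fun x => ‖fderiv ℝ φ (f x)‖ₑ ^ 2 with hh
  have hhm : Measurable h := by
    classical
    have h1 : ContinuousOn (fun x => ‖fderiv ℝ φ (f x)‖ₑ ^ 2) c :=
      ((ENNReal.continuous_pow 2).comp
        (hφ.continuous_fderiv one_ne_zero).enorm).comp_continuousOn hf.continuousOn
    rw [hh, ← piecewise_eq_indicator]
    exact h1.measurable_piecewise continuousOn_const hco.measurableSet
  have hpt : ∀ x ∈ c, ∀ y ∈ c, ‖φ (f x) - φ (f y)‖ₑ ^ 2 ≤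
      A * ∫⁻ t in Ioo (0 : ℝ) 1, h ((1 - t) • x + t • y) := by
    intro x hx y hy
    have hmem : ∀ t ∈ Icc (0 : ℝ) 1, (1 - t) • x + t • y ∈ c := fun t ht =>
      hc hx hy (by linarith [ht.2]) ht.1 (by ring)
    have hlip : LipschitzOnWith L (fun t : ℝ => f ((1 - t) • x + t • y)) (Icc 0 1) := by
      have h1 : LipschitzOnWith R.toNNReal (fun t : ℝ => (1 - t) • x + t • y) (Icc 0 1) := by
        refine LipschitzOnWith.of_dist_le_mul fun s _ t _ => ?_
        have h2 : ((1 - s) • x + s • y) - ((1 - t) • x + t • y) = (s - t) • (y - x) := by module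
        rw [dist_eq_norm, h2, norm_smul, mul_comm, ← dist_eq_norm, ← dist_eq_norm]
        gcongr
        exact (hR hy hx).trans (Real.le_coe_toNNReal R)
      exact hf.comp h1 hmem
    have h2 := enorm_comp_sub_sq_le_lintegral hφ zero_le_one hlip
    simp only [sub_zero, one_smul, zero_smul, add_zero, sub_self, zero_add] at h2
    rw [hA, sub_zero]
    refine h2.trans ?_
    rw [mul_one]
    refine mul_le_mul_right (setLIntegral_congr_fun measurableSet_Ioo fun t ht => ?_).le _
    simp only [hh, indicator_of_mem (hmem t (Ioo_subset_Icc_self ht))]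
  -- Tonelli moves the segment parameter outside; for each fixed `t` the convex-combination bound
  -- applies.
  calc _ ≤ ∫⁻ x in c, ∫⁻ y in c, A * ∫⁻ t in Ioo (0 : ℝ) 1, h ((1 - t) • x + t • y)
        ∂volume ∂μ ∂μ := by
        refine setLIntegral_mono' hco.measurableSet fun x hx => ?_
        exact setLIntegral_mono' hco.measurableSet fun y hy => hpt x hx y hy
    _ = A * ∫⁻ x in c, ∫⁻ y in c, ∫⁻ t in Ioo (0 : ℝ) 1, h ((1 - t) • x + t • y)
        ∂volume ∂μ ∂μ := by
        have hA' : A ≠ ⊤ := ENNReal.ofReal_ne_top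
        simp_rw [lintegral_const_mul' _ _ hA']
    _ = A * ∫⁻ t in Ioo (0 : ℝ) 1, ∫⁻ x in c, ∫⁻ y in c, h ((1 - t) • x + t • y) ∂μ ∂μ := by
        congr 1
        rw [lintegral_lintegral_swap (μ := volume.restrict (Ioo (0 : ℝ) 1))
          (f := fun t x => ∫⁻ y in c, h ((1 - t) • x + t • y) ∂μ)]
        · refine lintegral_congr fun x => ?_
          rw [lintegral_lintegral_swap]
          exact (hhm.comp (by fun_prop :
            Measurable fun p : W × ℝ => (1 - p.2) • x + p.2 • p.1)).aemeasurable
        · refine Measurable.aemeasurable ?_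
          exact Measurable.lintegral_prod_right'
            (f := fun p : (ℝ × W) × W => h ((1 - p.1.1) • p.1.2 + p.1.1 • p.2))
            (hhm.comp (by fun_prop))
    _ ≤ A * ∫⁻ _ in Ioo (0 : ℝ) 1, μ c * (2 ^ Module.finrank ℝ W * ∫⁻ x, h x ∂μ) := by
        gcongr with t
        exact lintegral_lintegral_convexComb_le μ hhm c
    _ = A * (μ c * 2 ^ Module.finrank ℝ W) * ∫⁻ x in c, ‖fderiv ℝ φ (f x)‖ₑ ^ 2 ∂μ := by
        rw [setLIntegral_const, hh, lintegral_indicator hco.measurableSet]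
        simp [mul_assoc]

end Convex

/-! ### Poincaré inequalities between pairs of measures. -/

theorem enorm_sub_sq_le (a b c : ℂ) : ‖a - c‖ₑ ^ 2 ≤ 2 * (‖a - b‖ₑ ^ 2 + ‖b - c‖ₑ ^ 2) := by
  have h : ‖a - c‖ ^ 2 ≤ 2 * (‖a - b‖ ^ 2 + ‖b - c‖ ^ 2) := by
    have h1 : ‖a - c‖ ≤ ‖a - b‖ + ‖b - c‖ := norm_sub_le_norm_sub_add_norm_sub a b c
    nlinarith [sq_nonneg (‖a - b‖ - ‖b - c‖), norm_nonneg (a - c)]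
  have h2 := ENNReal.ofReal_le_ofReal h
  rw [ENNReal.ofReal_mul (by norm_num), ENNReal.ofReal_add (by positivity) (by positivity),
    ENNReal.ofReal_pow (norm_nonneg _), ENNReal.ofReal_pow (norm_nonneg _),
    ENNReal.ofReal_pow (norm_nonneg _), ofReal_norm, ofReal_norm, ofReal_norm] at h2
  simpa using h2

theorem measurable_enorm_sub_sq {F : Type*} [TopologicalSpace F] [SecondCountableTopology F]
    [MeasurableSpace F] [BorelSpace F] {φ : F → ℂ} (hφ : Continuous φ) :
    Measurable fun p : F × F => ‖φ p.1 - φ p.2‖ₑ ^ 2 :=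
  Continuous.measurable (by fun_prop)

/-- The oscillation of `C¹` functions between the measures `μ` and `ν` is controlled by the
Dirichlet integral over `Ω`. -/
def PoincarePair {n : ℕ} (Ω : Set (EuclideanSpace ℝ (Fin n)))
    (μ ν : Measure (EuclideanSpace ℝ (Fin n))) : Prop :=
  ∃ C : NNReal, ∀ φ : EuclideanSpace ℝ (Fin n) → ℂ, ContDiff ℝ 1 φ →
    ∫⁻ x, ∫⁻ y, ‖φ x - φ y‖ₑ ^ 2 ∂ν ∂μ ≤ C * ∫⁻ x in Ω, ‖fderiv ℝ φ x‖ₑ ^ 2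

namespace PoincarePair

variable {n : ℕ} {Ω : Set (EuclideanSpace ℝ (Fin n))}
  {μ ν ρ : Measure (EuclideanSpace ℝ (Fin n))}

theorem symm [SFinite μ] [SFinite ν] (h : PoincarePair Ω μ ν) : PoincarePair Ω ν μ := by
  obtain ⟨C, hC⟩ := h
  refine ⟨C, fun φ hφ => ?_⟩
  rw [lintegral_lintegral_swap]
  · refine le_trans (le_of_eq ?_) (hC φ hφ)
    refine lintegral_congr fun x => lintegral_congr fun y => ?_
    rw [← enorm_neg, neg_sub]
  · exact (measurable_enorm_sub_sq hφ.continuous).aemeasurable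

/-- Domination up to a factor is what a bi-Lipschitz change of variables provides. -/
theorem mono (h : PoincarePair Ω μ ν) {μ' ν' : Measure (EuclideanSpace ℝ (Fin n))}
    {a b : NNReal} (hμ : μ' ≤ a • μ) (hν : ν' ≤ b • ν) : PoincarePair Ω μ' ν' := by
  obtain ⟨C, hC⟩ := h
  refine ⟨a * b * C, fun φ hφ => ?_⟩
  calc _ ≤ ∫⁻ x, ∫⁻ y, ‖φ x - φ y‖ₑ ^ 2 ∂(b • ν) ∂(a • μ) :=
        lintegral_mono' hμ fun x => lintegral_mono' hν le_rfl
    _ = a * (b * ∫⁻ x, ∫⁻ y, ‖φ x - φ y‖ₑ ^ 2 ∂ν ∂μ) := by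
        simp_rw [lintegral_smul_measure, ENNReal.smul_def, smul_eq_mul]
        rw [lintegral_const_mul' _ _ ENNReal.coe_ne_top]
    _ ≤ a * (b * (C * ∫⁻ x in Ω, ‖fderiv ℝ φ x‖ₑ ^ 2)) := by gcongr; exact hC φ hφ
    _ = _ := by push_cast; ring

theorem mono_restrict {s t s' t' : Set (EuclideanSpace ℝ (Fin n))}
    (h : PoincarePair Ω (μ.restrict s) (ν.restrict t)) (hs : s' ⊆ s) (ht : t' ⊆ t) :
    PoincarePair Ω (μ.restrict s') (ν.restrict t') :=
  h.mono (a := 1) (b := 1) (by simpa using Measure.restrict_mono_set μ hs)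
    (by simpa using Measure.restrict_mono_set ν ht)

/-- Average `‖φ x - φ y‖² ≤ 2 (‖φ x - φ z‖² + ‖φ z - φ y‖²)` over `z` with respect to `ν`, then
divide by the total mass of `ν`. This carries the inequality along chains of overlapping sets. -/
theorem trans [IsFiniteMeasure μ] [IsFiniteMeasure ν] [IsFiniteMeasure ρ] (hν : ν ≠ 0)
    (h₁ : PoincarePair Ω μ ν) (h₂ : PoincarePair Ω ν ρ) : PoincarePair Ω μ ρ := by
  obtain ⟨C₁, hC₁⟩ := h₁
  obtain ⟨C₂, hC₂⟩ := h₂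
  have hν0 : ν Set.univ ≠ 0 := by simpa using hν
  refine ⟨((ν Set.univ)⁻¹ * (2 * (ρ Set.univ * C₁ + μ Set.univ * C₂))).toNNReal, fun φ hφ => ?_⟩
  rw [ENNReal.coe_toNNReal (by finiteness)]
  set T := ∫⁻ x in Ω, ‖fderiv ℝ φ x‖ₑ ^ 2
  have hm := measurable_enorm_sub_sq hφ.continuous
  have hmx : ∀ x, Measurable fun y => ‖φ x - φ y‖ₑ ^ 2 := fun x =>
    Continuous.measurable (by have := hφ.continuous; fun_prop)
  have key : ∀ x y, ν Set.univ * ‖φ x - φ y‖ₑ ^ 2 ≤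
      2 * (∫⁻ z, ‖φ x - φ z‖ₑ ^ 2 ∂ν + ∫⁻ z, ‖φ z - φ y‖ₑ ^ 2 ∂ν) := fun x y => by
    rw [← lintegral_add_left (hmx x), ← lintegral_const_mul' _ _ (by simp), mul_comm,
      ← lintegral_const]
    exact lintegral_mono fun z => enorm_sub_sq_le _ _ _
  have h1 : ν Set.univ * ∫⁻ x, ∫⁻ y, ‖φ x - φ y‖ₑ ^ 2 ∂ρ ∂μ ≤
      2 * (ρ Set.univ * C₁ + μ Set.univ * C₂) * T := by
    calc _ = ∫⁻ x, ∫⁻ y, ν Set.univ * ‖φ x - φ y‖ₑ ^ 2 ∂ρ ∂μ := by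
          rw [← lintegral_const_mul' _ _ (by simp)]
          refine lintegral_congr fun x => ?_
          rw [lintegral_const_mul' _ _ (by simp)]
      _ ≤ ∫⁻ x, ∫⁻ y, 2 * (∫⁻ z, ‖φ x - φ z‖ₑ ^ 2 ∂ν + ∫⁻ z, ‖φ z - φ y‖ₑ ^ 2 ∂ν) ∂ρ ∂μ :=
          lintegral_mono fun x => lintegral_mono fun y => key x y
      _ = 2 * (ρ Set.univ * (∫⁻ x, ∫⁻ z, ‖φ x - φ z‖ₑ ^ 2 ∂ν ∂μ) +
            μ Set.univ * (∫⁻ z, ∫⁻ y, ‖φ z - φ y‖ₑ ^ 2 ∂ρ ∂ν)) := by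
          rw [lintegral_lintegral_swap (μ := ν) hm.aemeasurable]
          have h2 : ∀ x, ∫⁻ y, 2 * (∫⁻ z, ‖φ x - φ z‖ₑ ^ 2 ∂ν + ∫⁻ z, ‖φ z - φ y‖ₑ ^ 2 ∂ν) ∂ρ =
              2 * ((∫⁻ z, ‖φ x - φ z‖ₑ ^ 2 ∂ν) * ρ Set.univ +
                ∫⁻ y, ∫⁻ z, ‖φ z - φ y‖ₑ ^ 2 ∂ν ∂ρ) := fun x => by
            rw [lintegral_const_mul' _ _ ENNReal.ofNat_ne_top, lintegral_add_left measurable_const,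
              lintegral_const]
          simp_rw [h2]
          rw [lintegral_const_mul' _ _ ENNReal.ofNat_ne_top, lintegral_add_right _ measurable_const,
            lintegral_const, lintegral_mul_const' _ _ (measure_ne_top _ _), mul_comm (ρ _),
            mul_comm (μ _)]
      _ ≤ 2 * (ρ Set.univ * (C₁ * T) + μ Set.univ * (C₂ * T)) := by
          gcongr
          exacts [hC₁ φ hφ, hC₂ φ hφ]
      _ = _ := by ring
  rw [mul_assoc, mul_comm, ← div_eq_mul_inv,
    ENNReal.le_div_iff_mul_le (Or.inl hν0) (Or.inl (measure_ne_top _ _)), mul_comm]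
  exact h1

theorem finset_sum {ι : Type*} (t : Finset ι) {m : ι → Measure (EuclideanSpace ℝ (Fin n))}
    (h : ∀ i ∈ t, PoincarePair Ω (m i) ν) : PoincarePair Ω (∑ i ∈ t, m i) ν := by
  classical
  choose! C hC using h
  refine ⟨∑ i ∈ t, C i, fun φ hφ => ?_⟩
  rw [lintegral_finsetSum_measure, ENNReal.ofNNReal_finsetSum, Finset.sum_mul]
  exact Finset.sum_le_sum fun i hi => hC i hi φ hφ

end PoincarePair

/-! ### Lipschitz images and volume. -/

section Lipschitz

variable {n : ℕ}

/-- Volume is a multiple of `n`-dimensional Hausdorff measure, which a `K`-Lipschitz map enlarges by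
at most `K ^ n`; no Jacobian enters. -/
theorem volume_image_le_of_lipschitzOnWith {f : EuclideanSpace ℝ (Fin n) → EuclideanSpace ℝ (Fin n)}
    {K : NNReal} {s : Set (EuclideanSpace ℝ (Fin n))} (hf : LipschitzOnWith K f s) :
    volume (f '' s) ≤ (K ^ n : NNReal) * volume s := by
  have h := hf.hausdorffMeasure_image_le (d := n) (Nat.cast_nonneg n)
  rw [ENNReal.rpow_natCast] at h
  rw [← EuclideanSpace.euclideanHausdorffMeasure_eq_volume,
    Measure.euclideanHausdorffMeasure_def, Measure.smul_apply, Measure.smul_apply,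
    ENNReal.smul_def, ENNReal.smul_def, smul_eq_mul, smul_eq_mul, mul_left_comm]
  gcongr
  simpa using h

theorem volume_restrict_image_le {f : EuclideanSpace ℝ (Fin n) → EuclideanSpace ℝ (Fin n)}
    {K : NNReal} {c : Set (EuclideanSpace ℝ (Fin n))} (hc : MeasurableSet c)
    (hf : LipschitzOnWith K f c) :
    volume.restrict (f '' c) ≤ (K ^ n : NNReal) • Measure.map f (volume.restrict c) := by
  refine Measure.le_iff.2 fun A hA => ?_
  rw [Measure.restrict_apply hA, Measure.smul_apply,
    Measure.map_apply_of_aemeasurable (hf.continuousOn.aemeasurable hc) hA,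
    Measure.restrict_apply' hc, Set.inter_comm, ← Set.image_inter_preimage, Set.inter_comm]
  exact volume_image_le_of_lipschitzOnWith (hf.mono Set.inter_subset_right)

/-- The opposite comparison comes from the Lipschitz left inverse: the part of `c` that `f` sends
into `A` lies in the `g`-image of `A ∩ f '' c`. -/
theorem map_volume_restrict_le {f g : EuclideanSpace ℝ (Fin n) → EuclideanSpace ℝ (Fin n)}
    {K : NNReal} {c : Set (EuclideanSpace ℝ (Fin n))} (hc : MeasurableSet c)
    (hf : ContinuousOn f c) (hg : LipschitzOnWith K g (f '' c)) (hgf : ∀ x ∈ c, g (f x) = x) :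
    Measure.map f (volume.restrict c) ≤ (K ^ n : NNReal) • volume.restrict (f '' c) := by
  refine Measure.le_iff.2 fun A hA => ?_
  rw [Measure.smul_apply, Measure.map_apply_of_aemeasurable (hf.aemeasurable hc) hA,
    Measure.restrict_apply' hc, Measure.restrict_apply hA]
  have : f ⁻¹' A ∩ c ⊆ g '' (A ∩ f '' c) := fun x hx =>
    ⟨f x, ⟨hx.1, x, hx.2, rfl⟩, hgf x hx.2⟩
  exact (measure_mono this).trans
    (volume_image_le_of_lipschitzOnWith (hg.mono Set.inter_subset_right))

/-- Poincaré inequality on a bi-Lipschitz image of a bounded open convex set. -/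
theorem poincarePair_image {Ω : Set (EuclideanSpace ℝ (Fin n))}
    {f g : EuclideanSpace ℝ (Fin n) → EuclideanSpace ℝ (Fin n)}
    {K : NNReal} {c : Set (EuclideanSpace ℝ (Fin n))} (hc : Convex ℝ c) (hco : IsOpen c)
    (hcb : Bornology.IsBounded c)
    (hf : LipschitzOnWith K f c) (hg : LipschitzOnWith K g (f '' c)) (hgf : ∀ x ∈ c, g (f x) = x)
    (hΩ : f '' c ⊆ Ω) :
    PoincarePair Ω (volume.restrict (f '' c)) (volume.restrict (f '' c)) := by
  have hfm : AEMeasurable f (volume.restrict c) :=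
    hf.continuousOn.aemeasurable hco.measurableSet
  have hle := volume_restrict_image_le hco.measurableSet hf
  -- For the push-forward of the volume on `c`, the inequality becomes one on the convex set itself.
  suffices h : PoincarePair Ω (Measure.map f (volume.restrict c))
      (Measure.map f (volume.restrict c)) from h.mono hle hle
  obtain ⟨C, hC⟩ := lintegral_lintegral_comp_sub_sq_le volume hc hco hcb hf
  refine ⟨C * K ^ n, fun φ hφ => ?_⟩
  have hm := measurable_enorm_sub_sq hφ.continuous
  have : IsFiniteMeasure (volume.restrict c) := ⟨by simpa using hcb.measure_lt_top⟩
  rw [lintegral_map' hm.lintegral_prod_right'.aemeasurable hfm]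
  have h1 : ∀ x, ∫⁻ y, ‖φ (f x) - φ y‖ₑ ^ 2 ∂(Measure.map f (volume.restrict c)) =
      ∫⁻ y in c, ‖φ (f x) - φ (f y)‖ₑ ^ 2 := fun x =>
    lintegral_map' (hm.comp measurable_prodMk_left).aemeasurable hfm
  have hDm : Measurable fun x => ‖fderiv ℝ φ x‖ₑ ^ 2 :=
    ((ENNReal.continuous_pow 2).comp (hφ.continuous_fderiv one_ne_zero).enorm).measurable
  calc _ ≤ C * ∫⁻ x in c, ‖fderiv ℝ φ (f x)‖ₑ ^ 2 := by
        simp_rw [h1]; exact hC φ hφ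
    _ = C * ∫⁻ x, ‖fderiv ℝ φ x‖ₑ ^ 2 ∂(Measure.map f (volume.restrict c)) := by
        rw [lintegral_map' hDm.aemeasurable hfm]
    _ ≤ C * ∫⁻ x, ‖fderiv ℝ φ x‖ₑ ^ 2 ∂((K ^ n : NNReal) • volume.restrict Ω) := by
        gcongr
        refine (map_volume_restrict_le hco.measurableSet hf.continuousOn hg hgf).trans ?_
        gcongr
    _ = _ := by
        rw [lintegral_smul_measure, ENNReal.smul_def, smul_eq_mul, ENNReal.coe_mul, mul_assoc]

end Lipschitz

/-! ### Trace inequality at a flattened boundary piece. -/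

/-- The linear isometry `(t, y) ↦ y + t eᵢ`, where `y` has vanishing `i`-th coordinate. -/
def sliceMap {k : ℕ} (i : Fin (k + 1)) : ℝ × (Fin k → ℝ) →L[ℝ] EuclideanSpace ℝ (Fin (k + 1)) :=
  LinearMap.toContinuousLinearMap
    { toFun := fun p => WithLp.toLp 2 (i.insertNth p.1 p.2 : Fin (k + 1) → ℝ)
      map_add' := fun p q => by
        ext j
        refine i.succAboveCases ?_ (fun l => ?_) j <;> simp
      map_smul' := fun c p => by
        ext j
        refine i.succAboveCases ?_ (fun l => ?_) j <;> simp }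

section Slice

variable {k : ℕ} (i : Fin (k + 1))

@[simp] theorem sliceMap_apply_same (p : ℝ × (Fin k → ℝ)) : sliceMap i p i = p.1 := by
  simp [sliceMap]

theorem sliceMap_eq (t : ℝ) (y : Fin k → ℝ) :
    sliceMap i (t, y) = sliceMap i (0, y) + t • EuclideanSpace.single i 1 := by
  ext j
  refine i.succAboveCases ?_ (fun l => ?_) j <;> simp [sliceMap, Fin.succAbove_ne]

theorem exists_sliceMap_eq {q : EuclideanSpace ℝ (Fin (k + 1))} (hq : q i = 0) :
    ∃ y, sliceMap i (0, y) = q := by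
  refine ⟨fun l => q (i.succAbove l), ?_⟩
  ext j
  refine i.succAboveCases ?_ (fun l => ?_) j <;> simp [sliceMap, hq]

theorem dist_sliceMap (s t : ℝ) (y : Fin k → ℝ) :
    dist (sliceMap i (s, y)) (sliceMap i (t, y)) = dist s t := by
  rw [sliceMap_eq i s, sliceMap_eq i t, dist_add_left, dist_eq_norm, ← sub_smul, norm_smul]
  simp [Real.dist_eq]

theorem measurePreserving_sliceMap : MeasurePreserving (sliceMap i) := by
  have h1 := (EuclideanSpace.volume_preserving_symm_measurableEquiv_toLp (Fin (k + 1))).symm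
  have h2 := (volume_preserving_piFinSuccAbove (fun _ : Fin (k + 1) => ℝ) i).symm
  exact h1.comp h2

/-- Tonelli in the coordinates `(t, y)`; an inequality only, since the cylinder over `B` need not
fill `c`. -/
theorem lintegral_sliceMap_le {F : EuclideanSpace ℝ (Fin (k + 1)) → ENNReal} (hF : Measurable F)
    {c : Set (EuclideanSpace ℝ (Fin (k + 1)))} (hc : MeasurableSet c) {B : Set (Fin k → ℝ)}
    {I : Set ℝ} (hB : ∀ t ∈ I, ∀ y ∈ B, sliceMap i (t, y) ∈ c) :
    ∫⁻ y in B, ∫⁻ t in I, F (sliceMap i (t, y)) ≤ ∫⁻ x in c, F x := by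
  have hm : Measurable fun p => F (sliceMap i p) := hF.comp (sliceMap i).continuous.measurable
  calc _ = ∫⁻ p, F (sliceMap i p) ∂((volume.restrict I).prod (volume.restrict B)) :=
        (lintegral_prod_symm' _ hm).symm
    _ = ∫⁻ p in I ×ˢ B, F (sliceMap i p) := by
        rw [Measure.prod_restrict, Measure.volume_eq_prod]
    _ ≤ ∫⁻ p in sliceMap i ⁻¹' c, F (sliceMap i p) :=
        lintegral_mono_set fun p hp => hB _ hp.1 _ hp.2
    _ = _ := (measurePreserving_sliceMap i).setLIntegral_comp_preimage hc hF

end Slice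

theorem measurable_indicator_comp {X F : Type*} [TopologicalSpace X] [MeasurableSpace X]
    [BorelSpace X] [TopologicalSpace F] {c : Set X} (hc : IsOpen c) {f : X → F}
    (hf : ContinuousOn f c) {G : F → ENNReal} (hG : Continuous G) :
    Measurable (c.indicator fun x => G (f x)) := by
  classical
  rw [← Set.piecewise_eq_indicator]
  exact (hG.comp_continuousOn hf).measurable_piecewise continuousOn_const hc.measurableSet

theorem restrict_image_le_map_volume {k : ℕ} {X : Type*} [EMetricSpace X] [MeasurableSpace X]
    [BorelSpace X] {h : (Fin k → ℝ) → X} {K : NNReal} {B : Set (Fin k → ℝ)}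
    (hB : MeasurableSet B) (hh : LipschitzOnWith K h B) :
    ∃ C : NNReal, (Measure.euclideanHausdorffMeasure k : Measure X).restrict (h '' B) ≤
      C • Measure.map h (volume.restrict B) := by
  -- The first factor is the normalization of the Euclidean Hausdorff measure, the second the
  -- Lipschitz distortion.
  refine ⟨Measure.addHaarScalarFactor (volume : Measure (EuclideanSpace ℝ (Fin k)))
    (Measure.hausdorffMeasure k) * K ^ k, Measure.le_iff.2 fun A hA => ?_⟩
  rw [Measure.restrict_apply hA, Measure.smul_apply,
    Measure.map_apply_of_aemeasurable (hh.continuousOn.aemeasurable hB) hA,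
    Measure.restrict_apply' hB, Set.inter_comm, ← Set.image_inter_preimage, Set.inter_comm,
    Measure.euclideanHausdorffMeasure_def, Measure.smul_apply, mul_smul]
  gcongr
  have h1 := (hh.mono (Set.inter_subset_right : h ⁻¹' A ∩ B ⊆ B)).hausdorffMeasure_image_le
    (d := k) (Nat.cast_nonneg k)
  -- For the sup metric of `Fin k → ℝ`, the unnormalized Hausdorff measure is Lebesgue measure.
  have h2 : (Measure.hausdorffMeasure k : Measure (Fin k → ℝ)) = volume := by
    simpa using hausdorffMeasure_pi_real (ι := Fin k)
  rw [h2, ENNReal.rpow_natCast] at h1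
  simpa [ENNReal.smul_def] using h1

/-- Trace inequality on a bi-Lipschitz image of the flat boundary piece of a half ball. -/
theorem exists_lintegral_image_flat_le {k : ℕ} {Ω : Set (EuclideanSpace ℝ (Fin (k + 1)))}
    {i : Fin (k + 1)} {f g : EuclideanSpace ℝ (Fin (k + 1)) → EuclideanSpace ℝ (Fin (k + 1))}
    {K : NNReal} {q : EuclideanSpace ℝ (Fin (k + 1))} {r : ℝ} (hr : 0 < r)
    {c b S : Set (EuclideanSpace ℝ (Fin (k + 1)))}
    (hcdef : c = {y | y ∈ Metric.ball q (2 * r) ∧ 0 < y i})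
    (hS : S = f '' {y | y ∈ Metric.ball q r ∧ y i = 0}) (hb : Metric.ball q (2 * r) ⊆ b)
    (hf : LipschitzOnWith K f b) (hg : LipschitzOnWith K g (f '' c)) (hgf : ∀ x ∈ c, g (f x) = x)
    (hΩ : f '' c ⊆ Ω) :
    Measure.euclideanHausdorffMeasure k S < ⊤ ∧
    ∃ C : NNReal, ∀ φ : EuclideanSpace ℝ (Fin (k + 1)) → ℂ, ContDiff ℝ 1 φ →
      ∫⁻ x in S, ‖φ x‖ₑ ^ 2 ∂(Measure.euclideanHausdorffMeasure k) ≤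
        C * ((∫⁻ x in Ω, ‖φ x‖ₑ ^ 2) + ∫⁻ x in Ω, ‖fderiv ℝ φ x‖ₑ ^ 2) := by
  have hco : IsOpen c := by
    have hi : Continuous fun y : EuclideanSpace ℝ (Fin (k + 1)) => y i := by fun_prop
    rw [hcdef]
    exact Metric.isOpen_ball.inter (isOpen_lt continuous_const hi)
  have hcb : c ⊆ b := fun y hy => hb (by rw [hcdef] at hy; exact hy.1)
  have hcfin : volume c < ⊤ := (measure_mono (fun y hy => by rw [hcdef] at hy; exact hy.1)).trans_lt
    (measure_ball_lt_top (x := q) (r := 2 * r))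
  set B : Set (Fin k → ℝ) := {y | sliceMap i (0, y) ∈ Metric.ball q r} with hBdef
  have hBo : IsOpen B := Metric.isOpen_ball.preimage
    ((sliceMap i).continuous.comp (continuous_const.prodMk continuous_id))
  -- A cylinder of height `r` over the flat disc of radius `r` stays in the ball of radius `2 * r`.
  have hTb : ∀ t ∈ Set.Ico 0 r, ∀ y ∈ B, sliceMap i (t, y) ∈ Metric.ball q (2 * r) := by
    intro t ht y hy
    have h1 : dist (sliceMap i (0, y)) q < r := hy
    have h2 := dist_triangle (sliceMap i (t, y)) (sliceMap i (0, y)) q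
    rw [dist_sliceMap, Real.dist_eq, sub_zero, abs_of_nonneg ht.1] at h2
    rw [Metric.mem_ball]
    linarith [ht.2]
  have hTc : ∀ t ∈ Set.Ioo 0 r, ∀ y ∈ B, sliceMap i (t, y) ∈ c := by
    intro t ht y hy
    rw [hcdef]
    exact ⟨hTb t ⟨ht.1.le, ht.2⟩ y hy, by simpa using ht.1⟩
  -- The cylinder of height `r` over `B` lies in `c`, which has finite volume.
  have hBfin : volume B < ⊤ := by
    have h1 := lintegral_sliceMap_le i measurable_one hco.measurableSet hTc
    simp only [Pi.one_apply, lintegral_const, Measure.restrict_apply MeasurableSet.univ,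
      Set.univ_inter, one_mul, Real.volume_Ioo, sub_zero] at h1
    have h2 := h1.trans_lt hcfin
    by_contra h
    rw [not_lt, top_le_iff] at h
    rw [h, ENNReal.mul_top (by simpa using hr)] at h2
    exact lt_irrefl _ h2
  set h : (Fin k → ℝ) → EuclideanSpace ℝ (Fin (k + 1)) := fun y => f (sliceMap i (0, y)) with hh
  have hB0 : ∀ y ∈ B, sliceMap i (0, y) ∈ b := fun y hy => hb (hTb 0 ⟨le_rfl, hr⟩ y hy)
  have hhL : LipschitzOnWith (K * (‖sliceMap i‖₊ * 1)) h B :=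
    hf.comp (((sliceMap i).lipschitz.comp (LipschitzWith.prodMk_left 0)).lipschitzOnWith) hB0
  have hSB : S = h '' B := by
    rw [hS, hh]
    ext x
    constructor
    · rintro ⟨y, ⟨hy1, hy2⟩, rfl⟩
      obtain ⟨y', rfl⟩ := exists_sliceMap_eq i hy2
      exact ⟨y', hy1, rfl⟩
    · rintro ⟨y', hy', rfl⟩
      exact ⟨sliceMap i (0, y'), ⟨hy', by simp⟩, rfl⟩
  obtain ⟨C₀, hC₀⟩ := restrict_image_le_map_volume hBo.measurableSet hhL
  have hhm := hhL.continuousOn.aemeasurable (μ := volume) hBo.measurableSet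
  refine ⟨?_, ?_⟩
  · have h1 := hC₀ Set.univ
    rw [← hSB, Measure.restrict_apply_univ, Measure.smul_apply,
      Measure.map_apply_of_aemeasurable hhm MeasurableSet.univ, Set.preimage_univ,
      Measure.restrict_apply_univ] at h1
    exact h1.trans_lt (ENNReal.mul_lt_top ENNReal.coe_lt_top hBfin)
  set A : ENNReal := ENNReal.ofReal (K ^ 2 * r) with hA
  set R : ENNReal := ENNReal.ofReal r with hR
  have hR0 : R ≠ 0 := by simpa [hR] using hr
  -- `C₀` compares surface measure with `volume` on `B`, `R⁻¹` averages over heights, `R * A + 1`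
  -- stems from the vertical increment, and `K ^ (k + 1)` is the volume distortion of the chart.
  refine ⟨(C₀ * (R⁻¹ * (2 * (R * A + 1) * (K ^ (k + 1) : NNReal)))).toNNReal, fun φ hφ => ?_⟩
  rw [ENNReal.coe_toNNReal (by finiteness)]
  have hφc : Continuous fun x => ‖φ x‖ₑ ^ 2 := by have := hφ.continuous; fun_prop
  have hDc : Continuous fun x => ‖fderiv ℝ φ x‖ₑ ^ 2 := by
    have := hφ.continuous_fderiv one_ne_zero; fun_prop
  set G := c.indicator fun x => ‖φ (f x)‖ₑ ^ 2 with hG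
  set H := c.indicator fun x => ‖fderiv ℝ φ (f x)‖ₑ ^ 2 with hH
  have hfc := (hf.mono hcb).continuousOn
  have hGm : Measurable G := measurable_indicator_comp hco hfc hφc
  have hHm : Measurable H := measurable_indicator_comp hco hfc hDc
  -- The boundary value is compared with the value at height `t` along the image of the vertical
  -- segment.
  have hpt : ∀ y ∈ B, ∀ t ∈ Set.Ioo 0 r, ‖φ (h y)‖ₑ ^ 2 ≤
      2 * (A * (∫⁻ τ in Set.Ioo 0 r, H (sliceMap i (τ, y))) + G (sliceMap i (t, y))) := by
    intro y hy t ht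
    have h1 := enorm_sub_sq_le (φ (h y)) (φ (f (sliceMap i (t, y)))) 0
    rw [sub_zero, sub_zero] at h1
    refine h1.trans ?_
    rw [hG, Set.indicator_of_mem (hTc t ht y hy)]
    gcongr
    have hsub : ∀ s ∈ Set.Icc 0 t, sliceMap i (s, y) ∈ b := fun s hs =>
      hb (hTb s ⟨hs.1, hs.2.trans_lt ht.2⟩ y hy)
    have hlip : LipschitzOnWith (K * 1) (fun s => f (sliceMap i (s, y))) (Set.Icc 0 t) :=
      hf.comp (LipschitzOnWith.of_dist_le_mul fun s _ s' _ => by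
        rw [dist_sliceMap, NNReal.coe_one, one_mul]) hsub
    rw [mul_one] at hlip
    refine (enorm_comp_sub_sq_le_lintegral hφ ht.1.le hlip).trans ?_
    rw [hA]
    refine mul_le_mul' (ENNReal.ofReal_le_ofReal ?_) ?_
    · rw [sub_zero]
      have := ht.2.le
      gcongr
    · calc _ = ∫⁻ τ in Set.Ioo 0 t, H (sliceMap i (τ, y)) := by
            refine setLIntegral_congr_fun measurableSet_Ioo fun τ hτ => ?_
            simp only [hH, Set.indicator_of_mem (hTc τ ⟨hτ.1, hτ.2.trans ht.2⟩ y hy)]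
        _ ≤ _ := lintegral_mono_set (Set.Ioo_subset_Ioo_right ht.2.le)
  have hmG : Measurable fun p : (Fin k → ℝ) × ℝ => G (sliceMap i (p.2, p.1)) :=
    hGm.comp (Continuous.measurable (by fun_prop))
  have hmH : Measurable fun p : (Fin k → ℝ) × ℝ => H (sliceMap i (p.2, p.1)) :=
    hHm.comp (Continuous.measurable (by fun_prop))
  -- Integration over the heights `t`; the left side does not depend on `t` and gains the factor `R
  -- = r`.
  have hy : ∀ y ∈ B, R * ‖φ (h y)‖ₑ ^ 2 ≤
      2 * (R * A * (∫⁻ τ in Set.Ioo 0 r, H (sliceMap i (τ, y))) +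
        ∫⁻ t in Set.Ioo 0 r, G (sliceMap i (t, y))) := by
    intro y hy
    calc R * ‖φ (h y)‖ₑ ^ 2 = ∫⁻ _ in Set.Ioo 0 r, ‖φ (h y)‖ₑ ^ 2 := by
          rw [setLIntegral_const, Real.volume_Ioo, sub_zero, mul_comm]
      _ ≤ ∫⁻ t in Set.Ioo 0 r, 2 * (A * (∫⁻ τ in Set.Ioo 0 r, H (sliceMap i (τ, y))) +
            G (sliceMap i (t, y))) :=
          setLIntegral_mono' measurableSet_Ioo fun t ht => hpt y hy t ht
      _ = _ := by
          rw [lintegral_const_mul' _ _ ENNReal.ofNat_ne_top, lintegral_add_left measurable_const,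
            setLIntegral_const, Real.volume_Ioo, sub_zero]
          ring
  have hmain : R * ∫⁻ y in B, ‖φ (h y)‖ₑ ^ 2 ≤
      2 * (R * A * (∫⁻ x in c, H x) + ∫⁻ x in c, G x) := by
    calc R * ∫⁻ y in B, ‖φ (h y)‖ₑ ^ 2 = ∫⁻ y in B, R * ‖φ (h y)‖ₑ ^ 2 :=
          (lintegral_const_mul' _ _ ENNReal.ofReal_ne_top).symm
      _ ≤ ∫⁻ y in B, 2 * (R * A * (∫⁻ τ in Set.Ioo 0 r, H (sliceMap i (τ, y))) +
            ∫⁻ t in Set.Ioo 0 r, G (sliceMap i (t, y))) :=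
          setLIntegral_mono' hBo.measurableSet hy
      _ = 2 * (R * A * (∫⁻ y in B, ∫⁻ τ in Set.Ioo 0 r, H (sliceMap i (τ, y))) +
            ∫⁻ y in B, ∫⁻ t in Set.Ioo 0 r, G (sliceMap i (t, y))) := by
          rw [lintegral_const_mul' _ _ ENNReal.ofNat_ne_top,
            lintegral_add_left (hmH.lintegral_prod_right'.const_mul _),
            lintegral_const_mul' _ _ (by finiteness)]
      _ ≤ _ := by
          gcongr
          · exact lintegral_sliceMap_le i hHm hco.measurableSet hTc
          · exact lintegral_sliceMap_le i hGm hco.measurableSet hTc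
  have hmap : ∀ Φ : EuclideanSpace ℝ (Fin (k + 1)) → ENNReal, Continuous Φ →
      ∫⁻ x in c, c.indicator (fun x => Φ (f x)) x ≤
        (K ^ (k + 1) : NNReal) * ∫⁻ x in Ω, Φ x := by
    intro Φ hΦ
    have hfm : AEMeasurable f (volume.restrict c) := hfc.aemeasurable hco.measurableSet
    rw [setLIntegral_congr_fun hco.measurableSet (g := fun x => Φ (f x))
      fun x hx => Set.indicator_of_mem hx _, ← lintegral_map' hΦ.measurable.aemeasurable hfm]
    calc _ ≤ ∫⁻ x, Φ x ∂((K ^ (k + 1) : NNReal) • volume.restrict Ω) := by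
          refine lintegral_mono' ?_ le_rfl
          refine (map_volume_restrict_le hco.measurableSet hfc hg hgf).trans ?_
          gcongr
      _ = _ := by rw [lintegral_smul_measure, ENNReal.smul_def, smul_eq_mul]
  have hfinal : ∫⁻ y in B, ‖φ (h y)‖ₑ ^ 2 ≤ R⁻¹ * (2 * (R * A + 1) * (K ^ (k + 1) : NNReal)) *
      ((∫⁻ x in Ω, ‖φ x‖ₑ ^ 2) + ∫⁻ x in Ω, ‖fderiv ℝ φ x‖ₑ ^ 2) := by
    rw [mul_assoc, mul_comm R⁻¹, ← div_eq_mul_inv,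
      ENNReal.le_div_iff_mul_le (Or.inl hR0) (Or.inl ENNReal.ofReal_ne_top), mul_comm]
    refine hmain.trans ?_
    set a := ∫⁻ x in Ω, ‖φ x‖ₑ ^ 2
    set d := ∫⁻ x in Ω, ‖fderiv ℝ φ x‖ₑ ^ 2
    calc _ ≤ 2 * (R * A * ((K ^ (k + 1) : NNReal) * d) + (K ^ (k + 1) : NNReal) * a) := by
          gcongr
          exacts [hmap _ hDc, hmap _ hφc]
      _ ≤ 2 * (R * A * ((K ^ (k + 1) : NNReal) * (a + d)) +
            (K ^ (k + 1) : NNReal) * (a + d)) := by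
          gcongr
          exacts [le_add_self, le_self_add]
      _ = _ := by ring
  calc _ ≤ ∫⁻ x, ‖φ x‖ₑ ^ 2 ∂(C₀ • Measure.map h (volume.restrict B)) := by
        rw [hSB]; exact lintegral_mono' hC₀ le_rfl
    _ = C₀ * ∫⁻ y in B, ‖φ (h y)‖ₑ ^ 2 := by
        rw [lintegral_smul_measure, ENNReal.smul_def, smul_eq_mul,
          lintegral_map' hφc.measurable.aemeasurable hhm]
    _ ≤ _ := by rw [mul_assoc (C₀ : ENNReal)]; gcongr

theorem restrict_le_finset_sum {X ι : Type*} [MeasurableSpace X] (μ : Measure X) {s : Set X}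
    {t : Finset ι} {V : ι → Set X} (h : s ⊆ ⋃ i ∈ t, V i) :
    μ.restrict s ≤ ∑ i ∈ t, μ.restrict (V i ∩ s) := by
  refine Measure.le_iff.2 fun A hA => ?_
  rw [Measure.restrict_apply hA, Measure.finsetSum_apply]
  calc μ (A ∩ s) ≤ μ (⋃ i ∈ t, A ∩ (V i ∩ s)) := by
        refine measure_mono fun x hx => ?_
        obtain ⟨i, hi, hx'⟩ := Set.mem_iUnion₂.1 (h hx.2)
        exact Set.mem_iUnion₂.2 ⟨i, hi, hx.1, hx', hx.2⟩
    _ ≤ ∑ i ∈ t, μ (A ∩ (V i ∩ s)) := measure_biUnion_finset_le _ _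
    _ = _ := by simp_rw [Measure.restrict_apply hA]

/-! ### Poincaré and trace inequalities on a Lipschitz domain. -/

section Domain

variable {k : ℕ} {Ω : Set (EuclideanSpace ℝ (Fin (k + 1)))}

/-- A positive coordinate would put `z` into the open set `Ω`, away from its frontier; a negative
one would persist nearby and keep `z` out of the closure. -/
theorem chart_eq_zero_of_mem_frontier {n : ℕ} {Ω : Set (EuclideanSpace ℝ (Fin n))}
    (hΩ : IsOpen Ω) {i : Fin n}
    {e : OpenPartialHomeomorph (EuclideanSpace ℝ (Fin n)) (EuclideanSpace ℝ (Fin n))}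
    (he : ∀ z ∈ e.source, z ∈ Ω ↔ 0 < e z i) {z : EuclideanSpace ℝ (Fin n)} (hz : z ∈ e.source)
    (hzΩ : z ∈ frontier Ω) : e z i = 0 := by
  rw [hΩ.frontier_eq] at hzΩ
  refine le_antisymm (not_lt.1 fun h => hzΩ.2 ((he z hz).2 h)) (not_lt.1 fun h => ?_)
  have hc : ContinuousAt (fun y => e y i) z :=
    (by fun_prop : Continuous fun y : EuclideanSpace ℝ (Fin n) => y i).continuousAt.comp
      (e.continuousAt hz)
  have h1 : ∀ᶠ y in 𝓝 z, e y i < 0 ∧ y ∈ e.source :=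
    (hc.eventually (gt_mem_nhds h)).and (e.open_source.mem_nhds hz)
  obtain ⟨y, hy3, hy1, hy2⟩ := ((mem_closure_iff_frequently.1 hzΩ.1).and_eventually h1).exists
  exact lt_asymm hy1 ((he y hy2).1 hy3)

/-- Near a boundary point of a Lipschitz domain, the Poincaré inequality and the trace inequality
hold. -/
theorem IsLipschitzDomain.exists_nhds_frontier (hΩ : IsLipschitzDomain Ω)
    {x : EuclideanSpace ℝ (Fin (k + 1))} (hx : x ∈ frontier Ω) :
    (∃ V, IsOpen V ∧ x ∈ V ∧
      PoincarePair Ω (volume.restrict (V ∩ Ω)) (volume.restrict (V ∩ Ω))) ∧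
    ∃ V, IsOpen V ∧ x ∈ V ∧ surfaceMeasure Ω V < ⊤ ∧
      ∃ C : NNReal, ∀ φ : EuclideanSpace ℝ (Fin (k + 1)) → ℂ, ContDiff ℝ 1 φ →
        ∫⁻ x in V, ‖φ x‖ₑ ^ 2 ∂(surfaceMeasure Ω) ≤
          C * ((∫⁻ x in Ω, ‖φ x‖ₑ ^ 2) + ∫⁻ x in Ω, ‖fderiv ℝ φ x‖ₑ ^ 2) := by
  obtain ⟨hΩo, -, -, hch⟩ := hΩ
  obtain ⟨i, K, e, hxe, heL, hesL, he⟩ := hch x hx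
  obtain ⟨R, hR, hRt⟩ := Metric.isOpen_iff.1 e.open_target (e x) (e.map_source hxe)
  -- The half ball of radius `2 * r` serves the Poincaré inequality; the trace inequality uses the
  -- disc of radius `r`, leaving room for a cylinder above it.
  obtain ⟨r, rfl⟩ : ∃ r, R = 2 * r := ⟨R / 2, by ring⟩
  have hr0 : 0 < r := by linarith
  obtain ⟨c, hc⟩ : ∃ c : Set (EuclideanSpace ℝ (Fin (k + 1))),
    c = {y | y ∈ Metric.ball (e x) (2 * r) ∧ 0 < y i} := ⟨_, rfl⟩
  have hcm : ∀ y, y ∈ c ↔ y ∈ Metric.ball (e x) (2 * r) ∧ 0 < y i := fun y => by rw [hc]; rfl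
  have hci : Continuous fun y : EuclideanSpace ℝ (Fin (k + 1)) => y i := by fun_prop
  have hco : IsOpen c := hc ▸ Metric.isOpen_ball.inter (isOpen_lt continuous_const hci)
  have hconv : Convex ℝ c := hc ▸ (convex_ball _ _).inter
    (convex_halfSpace_gt (f := fun y : EuclideanSpace ℝ (Fin (k + 1)) => y i)
      (IsLinearMap.mk (fun _ _ => rfl) (fun _ _ => rfl)) 0)
  have hcb : Bornology.IsBounded c := Metric.isBounded_ball.subset fun y hy => ((hcm y).1 hy).1
  have hct : c ⊆ e.target := fun y hy => hRt ((hcm y).1 hy).1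
  set V := e.source ∩ e ⁻¹' Metric.ball (e x) (2 * r) with hV
  have hVΩ : V ∩ Ω = e.symm '' c := by
    ext z
    constructor
    · rintro ⟨⟨hz1, hz2⟩, hz3⟩
      exact ⟨e z, (hcm _).2 ⟨hz2, (he z hz1).1 hz3⟩, e.left_inv hz1⟩
    · rintro ⟨y, hy, rfl⟩
      have h1 := e.map_target (hct hy)
      refine ⟨⟨h1, ?_⟩, (he _ h1).2 ?_⟩
      · rw [Set.mem_preimage, e.right_inv (hct hy)]; exact ((hcm y).1 hy).1
      · rw [e.right_inv (hct hy)]; exact ((hcm y).1 hy).2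
  have hsub : e.symm '' c ⊆ Ω := hVΩ ▸ Set.inter_subset_right
  have hgL : LipschitzOnWith K e (e.symm '' c) := heL.mono (by
    rw [← hVΩ]; exact fun z hz => hz.1.1)
  have hgf : ∀ y ∈ c, e (e.symm y) = y := fun y hy => e.right_inv (hct hy)
  have hVo : IsOpen V := e.isOpen_inter_preimage Metric.isOpen_ball
  have hball : ∀ ρ : ℝ, 0 < ρ → x ∈ e.source ∩ e ⁻¹' Metric.ball (e x) ρ := fun ρ hρ =>
    ⟨hxe, Set.mem_preimage.2 (Metric.mem_ball_self hρ)⟩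
  refine ⟨⟨V, hVo, hball _ (mul_pos two_pos hr0), ?_⟩, ?_⟩
  · rw [hVΩ]
    exact poincarePair_image hconv hco hcb (hesL.mono hct) hgL hgf hsub
  · set V' := e.source ∩ e ⁻¹' Metric.ball (e x) r with hV'
    have hV'o : IsOpen V' := e.isOpen_inter_preimage Metric.isOpen_ball
    set S := e.symm '' {y | y ∈ Metric.ball (e x) r ∧ y i = 0} with hS
    have hV'S : V' ∩ frontier Ω ⊆ S := fun z hz =>
      ⟨e z, ⟨hz.1.2, chart_eq_zero_of_mem_frontier hΩo he hz.1.1 hz.2⟩, e.left_inv hz.1.1⟩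
    obtain ⟨hfin, C, hC⟩ := exists_lintegral_image_flat_le hr0 hc hS hRt hesL hgL hgf hsub
    refine ⟨V', hV'o, hball _ hr0, ?_, C, fun φ hφ => ?_⟩
    · rw [surfaceMeasure, Measure.restrict_apply hV'o.measurableSet]
      exact (measure_mono hV'S).trans_lt hfin
    · refine le_trans ?_ (hC φ hφ)
      rw [surfaceMeasure, Measure.restrict_restrict hV'o.measurableSet]
      exact lintegral_mono_set hV'S

theorem poincarePair_ball {n : ℕ} {Ω : Set (EuclideanSpace ℝ (Fin n))}
    {x : EuclideanSpace ℝ (Fin n)} {r : ℝ} (h : Metric.ball x r ⊆ Ω) :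
    PoincarePair Ω (volume.restrict (Metric.ball x r)) (volume.restrict (Metric.ball x r)) := by
  have := poincarePair_image (Ω := Ω) (f := id) (g := id) (convex_ball x r) Metric.isOpen_ball
    Metric.isBounded_ball LipschitzWith.id.lipschitzOnWith LipschitzWith.id.lipschitzOnWith
    (fun _ _ => rfl) (by simpa using h)
  simpa using this

theorem IsLipschitzDomain.exists_nhds_closure (hΩ : IsLipschitzDomain Ω)
    {x : EuclideanSpace ℝ (Fin (k + 1))} (hx : x ∈ closure Ω) :
    ∃ V, IsOpen V ∧ x ∈ V ∧
      PoincarePair Ω (volume.restrict (V ∩ Ω)) (volume.restrict (V ∩ Ω)) := by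
  by_cases hxΩ : x ∈ Ω
  · obtain ⟨r, hr, hrΩ⟩ := Metric.isOpen_iff.1 hΩ.1 x hxΩ
    refine ⟨Metric.ball x r, Metric.isOpen_ball, Metric.mem_ball_self hr, ?_⟩
    rw [Set.inter_eq_left.2 hrΩ]
    exact poincarePair_ball hrΩ
  · exact (hΩ.exists_nhds_frontier (by rw [hΩ.1.frontier_eq]; exact ⟨hx, hxΩ⟩)).1

/-- The Poincaré inequality on a Lipschitz domain. -/
theorem IsLipschitzDomain.poincarePair (hΩ : IsLipschitzDomain Ω) :
    PoincarePair Ω (volume.restrict Ω) (volume.restrict Ω) := by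
  have hfin : volume Ω < ⊤ := hΩ.2.2.1.measure_lt_top
  have hfin' : ∀ V : Set (EuclideanSpace ℝ (Fin (k + 1))),
      IsFiniteMeasure (volume.restrict (V ∩ Ω)) := fun V =>
    ⟨by simpa using (measure_mono Set.inter_subset_right).trans_lt hfin⟩
  have hfinΩ : IsFiniteMeasure (volume.restrict Ω) := ⟨by simpa using hfin⟩
  have hne : ∀ V : Set (EuclideanSpace ℝ (Fin (k + 1))), IsOpen V → (V ∩ Ω).Nonempty →
      volume.restrict (V ∩ Ω) ≠ 0 := fun V hV h => by
    rw [Ne, Measure.restrict_eq_zero]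
    exact ((hV.inter hΩ.1).measure_pos volume h).ne'
  choose! V hVo hxV hV using fun x (hx : x ∈ closure Ω) => hΩ.exists_nhds_closure hx
  set P : EuclideanSpace ℝ (Fin (k + 1)) → EuclideanSpace ℝ (Fin (k + 1)) → Prop := fun x y =>
    PoincarePair Ω (volume.restrict (V x ∩ Ω)) (volume.restrict (V y ∩ Ω)) with hP
  have hVne : ∀ x ∈ closure Ω, (V x ∩ Ω).Nonempty := fun x hx =>
    mem_closure_iff.1 hx _ (hVo x hx) (hxV x hx)
  -- The volume on the overlap, nonzero because it is open and nonempty, is the intermediate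
  -- measure.
  have link : ∀ x ∈ closure Ω, ∀ y ∈ closure Ω, (V x ∩ V y ∩ Ω).Nonempty → P x y := by
    intro x hx y hy h
    refine PoincarePair.trans (hne _ ((hVo x hx).inter (hVo y hy)) h)
      ((hV x hx).mono_restrict subset_rfl ?_) ((hV y hy).mono_restrict ?_ subset_rfl)
    · exact Set.inter_subset_inter_left _ Set.inter_subset_left
    · exact Set.inter_subset_inter_left _ Set.inter_subset_right
  have htrans : ∀ x y z, y ∈ closure Ω → P x y → P y z → P x z := fun x y z hy h1 h2 =>
    PoincarePair.trans (hne _ (hVo y hy) (hVne y hy)) h1 h2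
  have hin : ∀ x ∈ Ω, ∀ y ∈ Ω, P x y := by
    intro x hx y hy
    -- A symmetric, transitive relation that holds between nearby points of a connected set holds
    -- between all its points.
    refine hΩ.2.1.isPreconnected.induction₂ P (fun z hz => ?_)
      (fun a b d _ hb _ => htrans a b d (subset_closure hb)) (fun a b _ _ h => h.symm) hx hy
    filter_upwards [mem_nhdsWithin_of_mem_nhds ((hVo z (subset_closure hz)).mem_nhds
      (hxV z (subset_closure hz))), self_mem_nhdsWithin] with y hy1 hy2
    exact link z (subset_closure hz) y (subset_closure hy2)
      ⟨y, ⟨hy1, hxV y (subset_closure hy2)⟩, hy2⟩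
  obtain ⟨y₀, hy₀⟩ := hΩ.2.1.nonempty
  have hy₀' := subset_closure hy₀
  -- A neighbourhood of a boundary point meets `Ω`, which links it to an interior point.
  have hall : ∀ x ∈ closure Ω, P x y₀ := by
    intro x hx
    obtain ⟨z, hz1, hz2⟩ := hVne x hx
    have hz' := subset_closure hz2
    exact htrans x z y₀ hz' (link x hx z hz' ⟨z, ⟨hz1, hxV z hz'⟩, hz2⟩) (hin z hz2 y₀ hy₀)
  obtain ⟨t, ht, htc⟩ := hΩ.2.2.1.isCompact_closure.elim_nhds_subcover V
    fun x hx => (hVo x hx).mem_nhds (hxV x hx)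
  have h1 : PoincarePair Ω (volume.restrict Ω) (volume.restrict (V y₀ ∩ Ω)) :=
    (PoincarePair.finset_sum t fun x hx => hall x (ht x hx)).mono (a := 1) (b := 1)
      (by simpa using restrict_le_finset_sum volume (subset_closure.trans htc)) (by simp)
  exact h1.trans (hne _ (hVo _ hy₀') (hVne _ hy₀')) h1.symm

/-- The trace inequality on a Lipschitz domain. -/
theorem IsLipschitzDomain.exists_lintegral_surfaceMeasure_le (hΩ : IsLipschitzDomain Ω) :
    surfaceMeasure Ω Set.univ < ⊤ ∧
    ∃ C : NNReal, ∀ φ : EuclideanSpace ℝ (Fin (k + 1)) → ℂ, ContDiff ℝ 1 φ →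
      ∫⁻ x, ‖φ x‖ₑ ^ 2 ∂(surfaceMeasure Ω) ≤
        C * ((∫⁻ x in Ω, ‖φ x‖ₑ ^ 2) + ∫⁻ x in Ω, ‖fderiv ℝ φ x‖ₑ ^ 2) := by
  choose! V hVo hxV hVfin C hC using fun x (hx : x ∈ frontier Ω) => (hΩ.exists_nhds_frontier hx).2
  obtain ⟨t, ht, htc⟩ := (hΩ.2.2.1.isCompact_closure.of_isClosed_subset isClosed_frontier
    frontier_subset_closure).elim_nhds_subcover V fun x hx => (hVo x hx).mem_nhds (hxV x hx)
  have hle : surfaceMeasure Ω ≤ ∑ x ∈ t, (surfaceMeasure Ω).restrict (V x) := by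
    have h1 := restrict_le_finset_sum
      (Measure.euclideanHausdorffMeasure (k + 1 - 1)) htc
    refine h1.trans (le_of_eq (Finset.sum_congr rfl fun x hx => ?_))
    rw [surfaceMeasure, Measure.restrict_restrict (hVo x (ht x hx)).measurableSet]
  constructor
  · refine (hle Set.univ).trans_lt ?_
    rw [Measure.finsetSum_apply]
    refine ENNReal.sum_lt_top.2 fun x hx => ?_
    rw [Measure.restrict_apply_univ]
    exact hVfin x (ht x hx)
  · refine ⟨∑ x ∈ t, C x, fun φ hφ => (lintegral_mono' hle le_rfl).trans ?_⟩
    rw [lintegral_finsetSum_measure, ENNReal.ofNNReal_finsetSum, Finset.sum_mul]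
    exact Finset.sum_le_sum fun x hx => hC x (ht x hx) φ hφ

/-- The Poincaré inequality, including boundary values. -/
theorem IsLipschitzDomain.exists_lintegral_sub_const_le (hΩ : IsLipschitzDomain Ω) :
    ∃ C : NNReal, ∀ φ : EuclideanSpace ℝ (Fin (k + 1)) → ℂ, ContDiff ℝ 1 φ → ∃ a : ℂ,
      ∫⁻ x in Ω, ‖φ x - a‖ₑ ^ 2 ≤ C * ∫⁻ x in Ω, ‖fderiv ℝ φ x‖ₑ ^ 2 ∧
      ∫⁻ x, ‖φ x - a‖ₑ ^ 2 ∂(surfaceMeasure Ω) ≤ C * ∫⁻ x in Ω, ‖fderiv ℝ φ x‖ₑ ^ 2 := by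
  obtain ⟨C₁, hC₁⟩ := hΩ.poincarePair
  obtain ⟨-, C₂, hC₂⟩ := hΩ.exists_lintegral_surfaceMeasure_le
  have hfin : volume Ω ≠ ⊤ := hΩ.2.2.1.measure_lt_top.ne
  have hpos : volume Ω ≠ 0 := (hΩ.1.measure_pos volume hΩ.2.1.nonempty).ne'
  set M : NNReal := ((volume Ω)⁻¹ * C₁).toNNReal with hM
  have hMe : (M : ENNReal) = (volume Ω)⁻¹ * C₁ := ENNReal.coe_toNNReal (by finiteness)
  refine ⟨M + C₂ * (M + 1), fun φ hφ => ?_⟩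
  set T := ∫⁻ x in Ω, ‖fderiv ℝ φ x‖ₑ ^ 2 with hT
  have hm := measurable_enorm_sub_sq hφ.continuous
  -- Some `y` does no worse than the average in the double integral; the constant is then `a = φ y`.
  obtain ⟨y, -, hy⟩ := exists_le_setLAverage hpos hfin
    (hm.lintegral_prod_right' (ν := volume.restrict Ω)).aemeasurable
  have h1 : ∫⁻ x in Ω, ‖φ x - φ y‖ₑ ^ 2 ≤ M * T := by
    calc _ = ∫⁻ x in Ω, ‖φ y - φ x‖ₑ ^ 2 :=
          lintegral_congr fun x => by rw [← enorm_neg, neg_sub]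
      _ ≤ _ := hy
      _ ≤ (volume Ω)⁻¹ * (C₁ * T) := by
          rw [setLAverage_eq, ENNReal.div_eq_inv_mul]
          gcongr
          exact hC₁ φ hφ
      _ = _ := by rw [hMe, mul_assoc]
  refine ⟨φ y, h1.trans ?_, ?_⟩
  · gcongr; exact le_self_add
  -- Subtracting a constant leaves the derivative unchanged, so the trace inequality applied to `φ -
  -- φ y` reduces to the bound just obtained.
  · refine (hC₂ (fun x => φ x - φ y) (hφ.sub contDiff_const)).trans ?_
    simp_rw [fderiv_sub_const]
    calc _ ≤ (C₂ : ENNReal) * (M * T + T) := by gcongr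
      _ = C₂ * (M + 1) * T := by ring
      _ ≤ _ := by gcongr; push_cast; exact le_add_self

end Domain

/-! ### Potentials with traces as a closure of smooth functions. -/

section TraceGraph

variable {n : ℕ} (Ω : Set (EuclideanSpace ℝ (Fin n)))

/-- The space `L²(Ω) × L²(Ω)ⁿ × L²(∂Ω)` of potentials, gradients and boundary values. -/
abbrev GraphSpace :=
  Lp ℂ 2 (volume.restrict Ω) × Lp (EuclideanSpace ℂ (Fin n)) 2 (volume.restrict Ω) ×
    Lp ℂ 2 (surfaceMeasure Ω)

theorem classicalGrad_add {φ ψ : EuclideanSpace ℝ (Fin n) → ℂ} (hφ : Differentiable ℝ φ)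
    (hψ : Differentiable ℝ ψ) : classicalGrad (φ + ψ) = classicalGrad φ + classicalGrad ψ := by
  ext x i
  simp [classicalGrad, fderiv_add (hφ x) (hψ x)]

theorem classicalGrad_const_smul {φ : EuclideanSpace ℝ (Fin n) → ℂ} (hφ : Differentiable ℝ φ)
    (a : ℂ) : classicalGrad (a • φ) = a • classicalGrad φ := by
  ext x i
  simp [classicalGrad, fderiv_const_smul (hφ x) a]

theorem classicalGrad_const (a : ℂ) :
    classicalGrad (fun _ : EuclideanSpace ℝ (Fin n) => a) = 0 := by
  ext x i
  simp [classicalGrad]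

theorem continuous_classicalGrad {φ : EuclideanSpace ℝ (Fin n) → ℂ} (hφ : ContDiff ℝ 1 φ) :
    Continuous (classicalGrad φ) := by
  have h := hφ.continuous_fderiv one_ne_zero
  refine (PiLp.continuous_toLp 2 _).comp (continuous_pi fun i => ?_)
  exact h.clm_apply continuous_const

/-- Cauchy-Schwarz in the coordinates. Equality can fail for complex-valued functions: with partial
derivatives `1, i` in the plane the norms are `1` and `√2`. -/
theorem norm_fderiv_le_norm_classicalGrad (φ : EuclideanSpace ℝ (Fin n) → ℂ)
    (x : EuclideanSpace ℝ (Fin n)) : ‖fderiv ℝ φ x‖ ≤ ‖classicalGrad φ x‖ := by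
  refine ContinuousLinearMap.opNorm_le_bound _ (norm_nonneg _) fun v => ?_
  have hv : v = ∑ i, v i • EuclideanSpace.single i (1 : ℝ) := by
    ext j
    simp [Finset.sum_apply, Pi.single_apply]
  have h1 : fderiv ℝ φ x v = ∑ i, (v i : ℂ) * classicalGrad φ x i := by
    conv_lhs => rw [hv]
    simp [classicalGrad, map_sum]
  calc ‖fderiv ℝ φ x v‖ ≤ ∑ i, ‖v i‖ * ‖classicalGrad φ x i‖ := by
        rw [h1]
        refine (norm_sum_le _ _).trans (le_of_eq ?_)
        simp
    _ ≤ √(∑ i, ‖v i‖ ^ 2) * √(∑ i, ‖classicalGrad φ x i‖ ^ 2) :=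
        Real.sum_mul_le_sqrt_mul_sqrt _ _ _
    _ = _ := by rw [← EuclideanSpace.norm_eq, ← EuclideanSpace.norm_eq, mul_comm]

/-- The smooth functions, with their gradients and boundary values. -/
def smoothGraph : Submodule ℂ (GraphSpace Ω) where
  carrier := {p | ∃ φ : EuclideanSpace ℝ (Fin n) → ℂ, ContDiff ℝ ((⊤ : ℕ∞) : WithTop ℕ∞) φ ∧
    p.1 =ᵐ[volume.restrict Ω] φ ∧ p.2.1 =ᵐ[volume.restrict Ω] classicalGrad φ ∧
    p.2.2 =ᵐ[surfaceMeasure Ω] φ}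
  zero_mem' := ⟨fun _ => 0, contDiff_const, Lp.coeFn_zero _ _ _, by
    rw [classicalGrad_const]; exact Lp.coeFn_zero _ _ _, Lp.coeFn_zero _ _ _⟩
  add_mem' := by
    rintro p q ⟨φ, hφ, h1, h2, h3⟩ ⟨ψ, hψ, h4, h5, h6⟩
    refine ⟨φ + ψ, hφ.add hψ, (Lp.coeFn_add _ _).trans (h1.add h4), ?_,
      (Lp.coeFn_add _ _).trans (h3.add h6)⟩
    rw [classicalGrad_add (hφ.differentiable (by simp)) (hψ.differentiable (by simp))]
    exact (Lp.coeFn_add _ _).trans (h2.add h5)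
  smul_mem' := by
    rintro a p ⟨φ, hφ, h1, h2, h3⟩
    refine ⟨a • φ, contDiff_const.smul hφ, (Lp.coeFn_smul _ _).trans (h1.const_smul a), ?_,
      (Lp.coeFn_smul _ _).trans (h3.const_smul a)⟩
    rw [classicalGrad_const_smul (hφ.differentiable (by simp))]
    exact (Lp.coeFn_smul _ _).trans (h2.const_smul a)

/-- The graph of the trace operator: the `H¹`-functions, with their gradients and traces. -/
def traceGraph : Submodule ℂ (GraphSpace Ω) := (smoothGraph Ω).topologicalClosure

variable {Ω}

theorem memLp_volume_of_continuous {F : Type*} [NormedAddCommGroup F]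
    (hΩ : IsOpen Ω) (hb : Bornology.IsBounded Ω) {ψ : EuclideanSpace ℝ (Fin n) → F}
    [SecondCountableTopology F] (hψ : Continuous ψ) (p : ENNReal) :
    MemLp ψ p (volume.restrict Ω) := by
  have : IsFiniteMeasure (volume.restrict Ω) := ⟨by simpa using hb.measure_lt_top⟩
  obtain ⟨C, hC⟩ := hb.isCompact_closure.exists_bound_of_continuousOn hψ.continuousOn
  refine MemLp.of_bound hψ.aestronglyMeasurable C ?_
  exact (ae_restrict_mem hΩ.measurableSet).mono fun x hx => hC x (subset_closure hx)

theorem memLp_surfaceMeasure_of_continuous {F : Type*} [NormedAddCommGroup F]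
    (hb : Bornology.IsBounded Ω) [IsFiniteMeasure (surfaceMeasure Ω)]
    {ψ : EuclideanSpace ℝ (Fin n) → F}
    [SecondCountableTopology F] (hψ : Continuous ψ) (p : ENNReal) :
    MemLp ψ p (surfaceMeasure Ω) := by
  obtain ⟨C, hC⟩ := hb.isCompact_closure.exists_bound_of_continuousOn hψ.continuousOn
  refine MemLp.of_bound hψ.aestronglyMeasurable C ?_
  exact (ae_restrict_mem isClosed_frontier.measurableSet).mono fun x hx =>
    hC x (frontier_subset_closure hx)

/-- With `hasTrace_of_mem_traceGraph`, this turns the sequential definition of traces into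
membership in a closed subspace. -/
theorem HasTrace.toLp_mem_traceGraph (hΩ : IsOpen Ω) (hb : Bornology.IsBounded Ω)
    [IsFiniteMeasure (surfaceMeasure Ω)]
    {u : EuclideanSpace ℝ (Fin n) → ℂ}
    {G : EuclideanSpace ℝ (Fin n) → EuclideanSpace ℂ (Fin n)} {g : EuclideanSpace ℝ (Fin n) → ℂ}
    (hu : MemLp u 2 (volume.restrict Ω)) (hG : MemLp G 2 (volume.restrict Ω))
    (h : HasTrace Ω u G g) :
    ((hu.toLp u, hG.toLp G, h.1.toLp g) : GraphSpace Ω) ∈ traceGraph Ω := by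
  obtain ⟨φ, hφ, h1, h2, h3⟩ := h.2
  have m1 : ∀ k, MemLp (φ k) 2 (volume.restrict Ω) := fun k =>
    memLp_volume_of_continuous hΩ hb (hφ k).continuous 2
  have m2 : ∀ k, MemLp (classicalGrad (φ k)) 2 (volume.restrict Ω) := fun k =>
    memLp_volume_of_continuous hΩ hb (continuous_classicalGrad ((hφ k).of_le (by simp))) 2
  have m3 : ∀ k, MemLp (φ k) 2 (surfaceMeasure Ω) := fun k =>
    memLp_surfaceMeasure_of_continuous hb (hφ k).continuous 2
  refine mem_closure_of_tendsto (f := fun k =>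
    (((m1 k).toLp (φ k), (m2 k).toLp (classicalGrad (φ k)), (m3 k).toLp (φ k)) : GraphSpace Ω))
    (b := atTop) ?_ (Eventually.of_forall fun k => ?_)
  · refine Tendsto.prodMk_nhds ?_ (Tendsto.prodMk_nhds ?_ ?_)
    · exact (Lp.tendsto_Lp_iff_tendsto_eLpNorm'' _ _ _ _).2 h1
    · exact (Lp.tendsto_Lp_iff_tendsto_eLpNorm'' _ _ _ _).2 h2
    · exact (Lp.tendsto_Lp_iff_tendsto_eLpNorm'' _ _ _ _).2 h3
  · exact ⟨φ k, hφ k, (m1 k).coeFn_toLp, (m2 k).coeFn_toLp, (m3 k).coeFn_toLp⟩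

theorem hasTrace_of_mem_traceGraph {p : GraphSpace Ω} (hp : p ∈ traceGraph Ω) :
    HasTrace Ω p.1 p.2.1 p.2.2 := by
  refine ⟨Lp.memLp _, ?_⟩
  obtain ⟨q, hq, hlim⟩ := mem_closure_iff_seq_limit.1 hp
  choose φ hφ h1 h2 h3 using hq
  have hc : ∀ {X F : Type} [MeasurableSpace X] [NormedAddCommGroup F] {μ : Measure X}
      {f : ℕ → Lp F 2 μ} {g : Lp F 2 μ} {F' : ℕ → X → F},
      Tendsto f atTop (𝓝 g) → (∀ k, f k =ᵐ[μ] F' k) →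
      Tendsto (fun k => eLpNorm (fun x => F' k x - g x) 2 μ) atTop (𝓝 0) := by
    intro X F _ _ μ f g F' hfg hF
    refine ((Lp.tendsto_Lp_iff_tendsto_eLpNorm' f g).1 hfg).congr fun k => eLpNorm_congr_ae ?_
    filter_upwards [hF k] with x hx
    simp [hx]
  have hf := (Prod.tendsto_iff _ _).1 hlim
  have hf2 := (Prod.tendsto_iff _ _).1 hf.2
  exact ⟨φ, hφ, hc hf.1 h1, hc hf2.1 h2, hc hf2.2 h3⟩

/-- The test function vanishes off `Ω`, so both integrals extend to the whole space and no boundary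
term arises. -/
theorem integral_mul_fderiv_eq_of_tsupport_subset {φ : EuclideanSpace ℝ (Fin n) → ℂ}
    (hφ : ContDiff ℝ 1 φ) {ψ : EuclideanSpace ℝ (Fin n) → ℝ} (hψ : ContDiff ℝ 1 ψ)
    (hψc : HasCompactSupport ψ) (hψΩ : tsupport ψ ⊆ Ω) (v : EuclideanSpace ℝ (Fin n)) :
    ∫ x in Ω, φ x * ((fderiv ℝ ψ x v : ℝ) : ℂ) = - ∫ x in Ω, fderiv ℝ φ x v * ((ψ x : ℝ) : ℂ) := by
  have hfd : ∀ x, fderiv ℝ (fun y => (ψ y : ℂ)) x v = ((fderiv ℝ ψ x v : ℝ) : ℂ) := fun x => by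
    have := (Complex.ofRealCLM.hasFDerivAt.comp x
      ((hψ.differentiable one_ne_zero) x).hasFDerivAt).fderiv
    have h2 : (fun y => (ψ y : ℂ)) = Complex.ofRealCLM ∘ ψ := rfl
    rw [h2, this]
    simp
  have hfc := hφ.continuous
  have hfd' := (hφ.continuous_fderiv one_ne_zero).clm_apply (continuous_const (y := v))
  have hpc := hψ.continuous
  have hpd := (hψ.continuous_fderiv one_ne_zero).clm_apply (continuous_const (y := v))
  have hsub : ∀ x, x ∉ Ω → fderiv ℝ ψ x v = 0 := fun x hx => by
    rw [image_eq_zero_of_notMem_tsupport (f := fderiv ℝ ψ)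
      fun h => hx (hψΩ (tsupport_fderiv_subset ℝ h))]
    simp
  have hsub' : ∀ x, x ∉ Ω → ψ x = 0 := fun x hx => image_eq_zero_of_notMem_tsupport fun h => hx (hψΩ h)
  rw [setIntegral_eq_integral_of_forall_compl_eq_zero fun x hx => by simp [hsub x hx],
    setIntegral_eq_integral_of_forall_compl_eq_zero fun x hx => by simp [hsub' x hx]]
  have hcψ : HasCompactSupport fun x => (ψ x : ℂ) := hψc.comp_left (g := fun t : ℝ => (t : ℂ)) (by simp)
  have hcd : HasCompactSupport fun x => ((fderiv ℝ ψ x v : ℝ) : ℂ) :=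
    (hψc.fderiv (𝕜 := ℝ)).comp_left (g := fun L : EuclideanSpace ℝ (Fin n) →L[ℝ] ℝ => ((L v : ℝ) : ℂ))
      (by simp)
  have key := integral_mul_fderiv_eq_neg_fderiv_mul_of_integrable (μ := volume) (v := v)
    (f := φ) (g := fun y => (ψ y : ℂ)) ?_ ?_ ?_
    (fun x _ => hφ.differentiable one_ne_zero x)
    (fun x _ => (Complex.ofRealCLM.contDiff.comp hψ).differentiable one_ne_zero x)
  · simpa only [hfd] using key
  · exact Continuous.integrable_of_hasCompactSupport (by fun_prop) hcψ.mul_left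
  · simp_rw [hfd]
    exact Continuous.integrable_of_hasCompactSupport (by fun_prop) hcd.mul_left
  · exact Continuous.integrable_of_hasCompactSupport (by fun_prop) hcψ.mul_left

/-- Both sides of the integration by parts formula are `L²` inner products with fixed functions, so
the identity passes from smooth functions to the closure. -/
theorem memH1_of_mem_traceGraph (hΩ : IsOpen Ω) (hb : Bornology.IsBounded Ω)
    {p : GraphSpace Ω} (hp : p ∈ traceGraph Ω) : MemH1 Ω p.1 p.2.1 := by
  refine ⟨Lp.memLp _, Lp.memLp _, fun ψ hψ hψc hψΩ i => ?_⟩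
  have hψ1 : ContDiff ℝ 1 ψ := hψ.of_le (by simp)
  have hpc := hψ.continuous
  have hpd := (hψ1.continuous_fderiv one_ne_zero).clm_apply
    (continuous_const (y := EuclideanSpace.single i (1 : ℝ)))
  have m1 : MemLp (fun x => ((fderiv ℝ ψ x (EuclideanSpace.single i 1) : ℝ) : ℂ)) 2
      (volume.restrict Ω) := memLp_volume_of_continuous hΩ hb (by fun_prop) 2
  have m2 : MemLp (fun x => (EuclideanSpace.single i (ψ x : ℂ) : EuclideanSpace ℂ (Fin n))) 2
      (volume.restrict Ω) := memLp_volume_of_continuous hΩ hb (by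
        refine (PiLp.continuous_toLp 2 _).comp (continuous_pi fun j => ?_)
        by_cases h : j = i
        · subst h; simp; fun_prop
        · simp [h]; fun_prop) 2
  have e1 : ∀ q : GraphSpace Ω, inner ℂ (m1.toLp _) q.1 =
      ∫ x in Ω, q.1 x * ((fderiv ℝ ψ x (EuclideanSpace.single i 1) : ℝ) : ℂ) := fun q => by
    rw [L2.inner_def]
    refine integral_congr_ae ?_
    filter_upwards [m1.coeFn_toLp] with x hx
    rw [hx, RCLike.inner_apply, Complex.conj_ofReal]
  have e2 : ∀ q : GraphSpace Ω, inner ℂ (m2.toLp _) q.2.1 =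
      ∫ x in Ω, q.2.1 x i * ((ψ x : ℝ) : ℂ) := fun q => by
    rw [L2.inner_def]
    refine integral_congr_ae ?_
    filter_upwards [m2.coeFn_toLp] with x hx
    rw [hx, EuclideanSpace.inner_single_left, Complex.conj_ofReal, mul_comm]
  rw [← e1, ← e2]
  have hcl : IsClosed {q : GraphSpace Ω | (inner ℂ (m1.toLp _) q.1 : ℂ) =
      - inner ℂ (m2.toLp _) q.2.1} :=
    isClosed_eq (by fun_prop) (by fun_prop)
  refine closure_minimal (fun q hq => ?_) hcl hp
  obtain ⟨φ, hφ, h1, h2, -⟩ := hq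
  have hφ1 : ContDiff ℝ 1 φ := hφ.of_le (by simp)
  have i1 : ∫ x in Ω, q.1 x * ((fderiv ℝ ψ x (EuclideanSpace.single i 1) : ℝ) : ℂ) =
      ∫ x in Ω, φ x * ((fderiv ℝ ψ x (EuclideanSpace.single i 1) : ℝ) : ℂ) :=
    integral_congr_ae (h1.mono fun x hx => by simp only [hx])
  have i2 : ∫ x in Ω, q.2.1 x i * ((ψ x : ℝ) : ℂ) =
      ∫ x in Ω, fderiv ℝ φ x (EuclideanSpace.single i 1) * ((ψ x : ℝ) : ℂ) :=
    integral_congr_ae (h2.mono fun x hx => by simp only [hx, classicalGrad])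
  rw [Set.mem_ofPred_eq, e1, e2, i1, i2]
  exact integral_mul_fderiv_eq_of_tsupport_subset hφ1 hψ1 hψc hψΩ _

end TraceGraph

/-! ### Functions that are constant on the electrodes. -/

section ElectrodeSpace

variable {n m : ℕ} (Ω : Set (EuclideanSpace ℝ (Fin n))) (E : Fin m → Set (EuclideanSpace ℝ (Fin n)))

/-- The `H¹`-functions which are constant on each electrode, with their values there. -/
def electrodeSpace : Submodule ℂ (GraphSpace Ω × (Fin m → ℂ)) where
  carrier := {x | x.1 ∈ traceGraph Ω ∧
    ∀ l, ∀ᵐ z ∂((surfaceMeasure Ω).restrict (E l)), x.1.2.2 z = x.2 l}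
  zero_mem' := ⟨Submodule.zero_mem _, fun _ => ae_restrict_of_ae (Lp.coeFn_zero _ _ _)⟩
  add_mem' := by
    rintro x y ⟨h1, h2⟩ ⟨h3, h4⟩
    refine ⟨Submodule.add_mem _ h1 h3, fun l => ?_⟩
    filter_upwards [h2 l, h4 l, ae_restrict_of_ae (Lp.coeFn_add x.1.2.2 y.1.2.2)] with z a b c
    exact c.trans (by rw [Pi.add_apply, a, b]; rfl)
  smul_mem' := by
    rintro a x ⟨h1, h2⟩
    refine ⟨Submodule.smul_mem _ a h1, fun l => ?_⟩
    filter_upwards [h2 l, ae_restrict_of_ae (Lp.coeFn_smul a x.1.2.2)] with z b c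
    exact c.trans (by rw [Pi.smul_apply, b]; rfl)

/-- The functions in `electrodeSpace` whose electrode values sum up to zero. -/
def groundedSpace : Submodule ℂ (GraphSpace Ω × (Fin m → ℂ)) :=
  electrodeSpace Ω E ⊓
    LinearMap.ker (∑ l, (LinearMap.proj l).comp (LinearMap.snd ℂ (GraphSpace Ω) (Fin m → ℂ)) :
      GraphSpace Ω × (Fin m → ℂ) →ₗ[ℂ] ℂ)

variable {Ω E}

theorem mem_electrodeSpace {x : GraphSpace Ω × (Fin m → ℂ)} :
    x ∈ electrodeSpace Ω E ↔ x.1 ∈ traceGraph Ω ∧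
      ∀ l, ∀ᵐ z ∂((surfaceMeasure Ω).restrict (E l)), x.1.2.2 z = x.2 l :=
  Iff.rfl

theorem mem_groundedSpace {x : GraphSpace Ω × (Fin m → ℂ)} :
    x ∈ groundedSpace Ω E ↔ x ∈ electrodeSpace Ω E ∧ ∑ l, x.2 l = 0 := by
  simp [groundedSpace]

/-- Being constant on `E l` is the equality of two continuous maps into `L²(E l)`: restriction of
the trace and embedding of the constant. -/
theorem isClosed_electrodeSpace [IsFiniteMeasure (surfaceMeasure Ω)] :
    IsClosed (electrodeSpace Ω E : Set (GraphSpace Ω × (Fin m → ℂ))) := by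
  have h : (electrodeSpace Ω E : Set (GraphSpace Ω × (Fin m → ℂ))) =
      Prod.fst ⁻¹' (traceGraph Ω : Set (GraphSpace Ω)) ∩ ⋂ l,
        {x : GraphSpace Ω × (Fin m → ℂ) | LpToLpRestrictCLM _ ℂ ℂ (surfaceMeasure Ω) 2 (E l) x.1.2.2 =
          Lp.constL 2 ((surfaceMeasure Ω).restrict (E l)) ℂ (x.2 l)} := by
    ext x
    simp only [Set.mem_inter_iff, Set.mem_iInter]
    refine and_congr Iff.rfl (forall_congr' fun l => ?_)
    have h1 := LpToLpRestrictCLM_coeFn ℂ (E l) x.1.2.2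
    have h2 := Lp.coeFn_const 2 ((surfaceMeasure Ω).restrict (E l)) (x.2 l)
    constructor
    · intro h
      refine Lp.ext (h1.trans ((show _ =ᵐ[_] _ from h).trans h2.symm))
    · intro h
      have h3 : LpToLpRestrictCLM _ ℂ ℂ (surfaceMeasure Ω) 2 (E l) x.1.2.2 =
          Lp.const 2 ((surfaceMeasure Ω).restrict (E l)) (x.2 l) := h
      rw [h3] at h1
      exact h1.symm.trans h2
  rw [h]
  refine ((smoothGraph Ω).isClosed_topologicalClosure.preimage continuous_fst).inter
    (isClosed_iInter fun l => isClosed_eq (by fun_prop) ?_)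
  exact (Lp.constL 2 ((surfaceMeasure Ω).restrict (E l)) ℂ).continuous.comp
    ((continuous_apply l).comp continuous_snd)

theorem isClosed_groundedSpace [IsFiniteMeasure (surfaceMeasure Ω)] :
    IsClosed (groundedSpace Ω E : Set (GraphSpace Ω × (Fin m → ℂ))) := by
  have h : (groundedSpace Ω E : Set (GraphSpace Ω × (Fin m → ℂ))) =
      (electrodeSpace Ω E : Set (GraphSpace Ω × (Fin m → ℂ))) ∩
        {x : GraphSpace Ω × (Fin m → ℂ) | ∑ l, x.2 l = 0} := by
    ext x
    exact mem_groundedSpace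
  rw [h]
  exact isClosed_electrodeSpace.inter (isClosed_eq (by fun_prop) continuous_const)

theorem MemH1Electrode.exists_mem_electrodeSpace (hΩ : IsOpen Ω) (hb : Bornology.IsBounded Ω)
    [IsFiniteMeasure (surfaceMeasure Ω)]
    {u : EuclideanSpace ℝ (Fin n) → ℂ}
    {G : EuclideanSpace ℝ (Fin n) → EuclideanSpace ℂ (Fin n)} {U : Fin m → ℂ}
    (h : MemH1Electrode Ω E u G U) : ∃ p : GraphSpace Ω, (p, U) ∈ electrodeSpace Ω E ∧
      p.1 =ᵐ[volume.restrict Ω] u ∧ p.2.1 =ᵐ[volume.restrict Ω] G := by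
  obtain ⟨⟨hu, hG, -⟩, g, hg, hU⟩ := h
  refine ⟨(hu.toLp u, hG.toLp G, hg.1.toLp g), ⟨hg.toLp_mem_traceGraph hΩ hb hu hG, fun l => ?_⟩,
    hu.coeFn_toLp, hG.coeFn_toLp⟩
  filter_upwards [hU l, ae_restrict_of_ae hg.1.coeFn_toLp] with z h1 h2
  exact h2.trans h1

theorem memH1Electrode_of_mem (hΩ : IsOpen Ω) (hb : Bornology.IsBounded Ω)
    {x : GraphSpace Ω × (Fin m → ℂ)} (hx : x ∈ electrodeSpace Ω E) :
    MemH1Electrode Ω E x.1.1 x.1.2.1 x.2 :=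
  ⟨memH1_of_mem_traceGraph hΩ hb hx.1, x.1.2.2, hasTrace_of_mem_traceGraph hx.1, hx.2⟩

theorem const_mem_electrodeSpace [IsFiniteMeasure (volume.restrict Ω)]
    [IsFiniteMeasure (surfaceMeasure Ω)] (a : ℂ) :
    ((Lp.const 2 (volume.restrict Ω) a, 0, Lp.const 2 (surfaceMeasure Ω) a), fun _ => a) ∈
      electrodeSpace Ω E := by
  refine ⟨Submodule.le_topologicalClosure _ ⟨fun _ => a, contDiff_const, Lp.coeFn_const _ _ _, ?_,
    Lp.coeFn_const _ _ _⟩, fun l => ae_restrict_of_ae (Lp.coeFn_const _ _ _)⟩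
  rw [classicalGrad_const]
  exact Lp.coeFn_zero _ _ _

theorem enorm_Lp_two_sq {X F : Type*} [MeasurableSpace X] {μ : Measure X} [NormedAddCommGroup F]
    (f : Lp F 2 μ) : ‖f‖ₑ ^ 2 = ∫⁻ x, ‖f x‖ₑ ^ 2 ∂μ := by
  rw [Lp.enorm_def]
  simpa using eLpNorm_nnreal_pow_eq_lintegral (μ := μ) (f := f) (p := 2) two_ne_zero

theorem norm_le_sqrt_mul_of_enorm_sq_le {A B : Type*} [NormedAddCommGroup A] [NormedAddCommGroup B]
    {a : A} {b : B} {C : NNReal} (h : ‖a‖ₑ ^ 2 ≤ C * ‖b‖ₑ ^ 2) : ‖a‖ ≤ √C * ‖b‖ := by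
  have h1 : ‖a‖₊ ^ 2 ≤ C * ‖b‖₊ ^ 2 := by
    rw [enorm_eq_nnnorm, enorm_eq_nnnorm] at h
    exact_mod_cast h
  have h2 : ‖a‖ ^ 2 ≤ C * ‖b‖ ^ 2 := by exact_mod_cast h1
  have h3 := Real.sqrt_le_sqrt h2
  rwa [Real.sqrt_sq (norm_nonneg _), Real.sqrt_mul C.coe_nonneg, Real.sqrt_sq (norm_nonneg _)] at h3

theorem le_of_forall_pos_le_mul_add {a A B : ℝ} (h : ∀ ε > 0, a ≤ A * ε + B) : a ≤ B := by
  have h1 : Tendsto (fun ε => A * ε + B) (𝓝[>] 0) (𝓝 (A * 0 + B)) :=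
    ((by fun_prop : Continuous fun ε => A * ε + B).tendsto 0).mono_left nhdsWithin_le_nhds
  rw [mul_zero, zero_add] at h1
  exact ge_of_tendsto h1 (eventually_mem_nhdsWithin.mono fun ε hε => h ε hε)

end ElectrodeSpace

/-! ### The gradient controls grounded functions. -/

section Coercive

variable {k m : ℕ} {Ω : Set (EuclideanSpace ℝ (Fin (k + 1)))}
  {E : Fin m → Set (EuclideanSpace ℝ (Fin (k + 1)))}

theorem IsLipschitzDomain.isFiniteMeasure_surfaceMeasure (hΩ : IsLipschitzDomain Ω) :
    IsFiniteMeasure (surfaceMeasure Ω) := ⟨hΩ.exists_lintegral_surfaceMeasure_le.1⟩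

theorem IsLipschitzDomain.isFiniteMeasure_volume {n : ℕ} {Ω : Set (EuclideanSpace ℝ (Fin n))}
    (hΩ : IsLipschitzDomain Ω) :
    IsFiniteMeasure (volume.restrict Ω) := ⟨by simpa using hΩ.2.2.1.measure_lt_top⟩

theorem IsLipschitzDomain.exists_norm_sub_const_le (hΩ : IsLipschitzDomain Ω)
    [IsFiniteMeasure (volume.restrict Ω)] [IsFiniteMeasure (surfaceMeasure Ω)] :
    ∃ C : ℝ, 0 ≤ C ∧ ∀ p ∈ smoothGraph Ω, ∃ a : ℂ,
      ‖p.1 - Lp.const 2 (volume.restrict Ω) a‖ ≤ C * ‖p.2.1‖ ∧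
      ‖p.2.2 - Lp.const 2 (surfaceMeasure Ω) a‖ ≤ C * ‖p.2.1‖ := by
  obtain ⟨C, hC⟩ := hΩ.exists_lintegral_sub_const_le
  refine ⟨√C, Real.sqrt_nonneg _, ?_⟩
  rintro p ⟨φ, hφ, h1, h2, h3⟩
  obtain ⟨a, ha1, ha2⟩ := hC φ (hφ.of_le (by simp))
  have hG : ∫⁻ x in Ω, ‖fderiv ℝ φ x‖ₑ ^ 2 ≤ ‖p.2.1‖ₑ ^ 2 := by
    rw [enorm_Lp_two_sq]
    refine lintegral_mono_ae ?_
    filter_upwards [h2] with x hx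
    rw [hx]
    gcongr
    rw [enorm_le_iff_norm_le]
    exact norm_fderiv_le_norm_classicalGrad φ x
  refine ⟨a, norm_le_sqrt_mul_of_enorm_sq_le ?_, norm_le_sqrt_mul_of_enorm_sq_le ?_⟩
  · rw [enorm_Lp_two_sq]
    calc _ = ∫⁻ x in Ω, ‖φ x - a‖ₑ ^ 2 := by
          refine lintegral_congr_ae ?_
          filter_upwards [h1, Lp.coeFn_sub p.1 (Lp.const 2 (volume.restrict Ω) a),
            Lp.coeFn_const 2 (volume.restrict Ω) a] with x hx hx2 hx3
          rw [hx2, Pi.sub_apply, hx, hx3, Function.const_apply]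
      _ ≤ _ := ha1.trans (by gcongr)
  · rw [enorm_Lp_two_sq]
    calc _ = ∫⁻ x, ‖φ x - a‖ₑ ^ 2 ∂(surfaceMeasure Ω) := by
          refine lintegral_congr_ae ?_
          filter_upwards [h3, Lp.coeFn_sub p.2.2 (Lp.const 2 (surfaceMeasure Ω) a),
            Lp.coeFn_const 2 (surfaceMeasure Ω) a] with x hx hx2 hx3
          rw [hx2, Pi.sub_apply, hx, hx3, Function.const_apply]
      _ ≤ _ := ha2.trans (by gcongr)

/-- On `s` the function `g - a` is the constant `c - a`. This compares an electrode value with the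
constant of the Poincaré inequality. -/
theorem norm_sub_le_of_ae_eq {X : Type*} [MeasurableSpace X] {σ : Measure X} [IsFiniteMeasure σ]
    {s : Set X} {g : Lp ℂ 2 σ} {c : ℂ} (hg : ∀ᵐ x ∂(σ.restrict s), g x = c) (a : ℂ) :
    ‖c - a‖ * √(σ.real s) ≤ ‖g - Lp.const 2 σ a‖ := by
  have h1 : ‖Lp.const 2 (σ.restrict s) (c - a)‖ ≤ ‖g - Lp.const 2 σ a‖ := by
    rw [Lp.norm_def, Lp.norm_def]
    refine ENNReal.toReal_mono (Lp.eLpNorm_ne_top _) ?_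
    refine le_trans (le_of_eq (eLpNorm_congr_ae ?_)) (eLpNorm_restrict_le _ 2 σ s)
    filter_upwards [hg, ae_restrict_of_ae (Lp.coeFn_sub g (Lp.const 2 σ a)),
      ae_restrict_of_ae (Lp.coeFn_const 2 σ a), Lp.coeFn_const 2 (σ.restrict s) (c - a)]
      with x h1 h2 h3 h4
    rw [h2, h4, Pi.sub_apply, h1, h3, Function.const_apply, Function.const_apply]
  rw [Lp.norm_const' _ _ _ (by simp) (by simp)] at h1
  simpa [Real.sqrt_eq_rpow] using h1

theorem exists_norm_Lp_const_le {X : Type*} [MeasurableSpace X] (μ : Measure X)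
    [IsFiniteMeasure μ] : ∃ c : ℝ, 0 ≤ c ∧ ∀ a : ℂ, ‖Lp.const 2 μ a‖ ≤ c * ‖a‖ :=
  ⟨μ.real Set.univ ^ (1 / (2 : ENNReal).toReal), by positivity, fun a =>
    (Lp.norm_const_le 2 μ a).trans_eq (mul_comm _ _)⟩

theorem norm_sub_le_dist_prod {A B C : Type*} [SeminormedAddCommGroup A] [SeminormedAddCommGroup B]
    [SeminormedAddCommGroup C] (p q : A × B × C) :
    ‖p.1 - q.1‖ ≤ dist p q ∧ ‖p.2.1 - q.2.1‖ ≤ dist p q ∧ ‖p.2.2 - q.2.2‖ ≤ dist p q := by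
  rw [dist_eq_norm]
  exact ⟨norm_fst_le (p - q), (norm_fst_le (p - q).2).trans (norm_snd_le (p - q)),
    (norm_snd_le (p - q).2).trans (norm_snd_le (p - q))⟩

theorem exists_norm_sub_le_of_mem_traceGraph {q : GraphSpace Ω} (hq : q ∈ traceGraph Ω) {ε : ℝ}
    (hε : 0 < ε) : ∃ p ∈ smoothGraph Ω, ‖q.1 - p.1‖ ≤ ε ∧ ‖q.2.1 - p.2.1‖ ≤ ε ∧
      ‖q.2.2 - p.2.2‖ ≤ ε := by
  have hq' : q ∈ closure (smoothGraph Ω : Set (GraphSpace Ω)) := hq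
  obtain ⟨p, hp, hpq⟩ := Metric.mem_closure_iff.1 hq' ε hε
  have h := norm_sub_le_dist_prod q p
  exact ⟨p, hp, h.1.trans hpq.le, h.2.1.trans hpq.le, h.2.2.trans hpq.le⟩

/-- The gradient controls the functions in `groundedSpace`. -/
theorem IsLipschitzDomain.exists_norm_le_norm_grad (hΩ : IsLipschitzDomain Ω) (hm : 0 < m)
    (hEpos : ∀ l, 0 < surfaceMeasure Ω (E l)) :
    ∃ C : ℝ, 0 ≤ C ∧ ∀ x ∈ groundedSpace Ω E, ‖x‖ ≤ C * ‖x.1.2.1‖ := by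
  have := hΩ.isFiniteMeasure_surfaceMeasure
  have := hΩ.isFiniteMeasure_volume
  obtain ⟨C, hC0, hC⟩ := hΩ.exists_norm_sub_const_le
  have hs : ∀ l, 0 < √((surfaceMeasure Ω).real (E l)) := fun l => by
    rw [Real.sqrt_pos, measureReal_def]
    exact ENNReal.toReal_pos (hEpos l).ne' (measure_ne_top _ _)
  set S := ∑ l, (√((surfaceMeasure Ω).real (E l)))⁻¹ with hS
  have hS0 : 0 ≤ S := Finset.sum_nonneg fun l _ => (inv_pos.2 (hs l)).le
  have hSl : ∀ l, (√((surfaceMeasure Ω).real (E l)))⁻¹ ≤ S := fun l =>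
    Finset.single_le_sum (f := fun l => (√((surfaceMeasure Ω).real (E l)))⁻¹)
      (fun l _ => (inv_pos.2 (hs l)).le) (Finset.mem_univ l)
  obtain ⟨c₁, hc₁0, hc₁⟩ := exists_norm_Lp_const_le (volume.restrict Ω)
  obtain ⟨c₂, hc₂0, hc₂⟩ := exists_norm_Lp_const_le (surfaceMeasure Ω)
  -- `K * δ` is the sum of the bounds obtained below for the function, its trace and its electrode
  -- values.
  obtain ⟨K, hK⟩ : ∃ K, K = 1 + c₁ * S + c₂ * S + 2 * S := ⟨_, rfl⟩
  have hK0 : 0 ≤ K := by rw [hK]; positivity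
  refine ⟨K * C + 1, by positivity, fun x hx => ?_⟩
  obtain ⟨hxY, hxs⟩ := mem_groundedSpace.1 hx
  obtain ⟨hxT, hxE⟩ := mem_electrodeSpace.1 hxY
  -- The Poincaré inequality is available for smooth functions only, so `x` is approximated up to
  -- `ε`, which then tends to zero.
  refine le_of_forall_pos_le_mul_add (A := K * (1 + C)) fun ε hε => ?_
  obtain ⟨p, hp, hp1, hp2, hp3⟩ := exists_norm_sub_le_of_mem_traceGraph hxT hε
  obtain ⟨a, ha1, ha2⟩ := hC p hp
  obtain ⟨δ, hδ⟩ : ∃ δ, δ = ε + C * (‖x.1.2.1‖ + ε) := ⟨_, rfl⟩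
  have hpG : ‖p.2.1‖ ≤ ‖x.1.2.1‖ + ε := by
    have := norm_le_norm_add_norm_sub x.1.2.1 p.2.1
    linarith
  have hCp : C * ‖p.2.1‖ ≤ C * (‖x.1.2.1‖ + ε) := by gcongr
  have h1 : ‖x.1.1 - Lp.const 2 (volume.restrict Ω) a‖ ≤ δ :=
    (norm_sub_le_norm_sub_add_norm_sub _ p.1 _).trans (by linarith)
  have h2 : ‖x.1.2.2 - Lp.const 2 (surfaceMeasure Ω) a‖ ≤ δ :=
    (norm_sub_le_norm_sub_add_norm_sub _ p.2.2 _).trans (by linarith)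
  have hδ0 : 0 ≤ δ := (norm_nonneg _).trans h1
  have h3 : ∀ l, ‖x.2 l - a‖ ≤ S * δ := fun l => by
    have h4 := (norm_sub_le_of_ae_eq (hxE l) a).trans h2
    calc ‖x.2 l - a‖ ≤ δ / √((surfaceMeasure Ω).real (E l)) := (le_div_iff₀ (hs l)).2 h4
      _ = (√((surfaceMeasure Ω).real (E l)))⁻¹ * δ := by rw [div_eq_inv_mul]
      _ ≤ S * δ := by gcongr; exact hSl l
  -- Grounding removes the free constant: the electrode values sum to zero, so `-a` is the mean of
  -- the differences `x.2 l - a`.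
  have h4 : ‖a‖ ≤ S * δ := by
    have h5 : ∑ l, (x.2 l - a) = -(m * a) := by
      rw [Finset.sum_sub_distrib, hxs]; simp
    have h6 : (m : ℝ) * ‖a‖ ≤ m * (S * δ) := by
      calc (m : ℝ) * ‖a‖ = ‖∑ l, (x.2 l - a)‖ := by rw [h5]; simp
        _ ≤ ∑ l : Fin m, S * δ := (norm_sum_le _ _).trans (Finset.sum_le_sum fun l _ => h3 l)
        _ = _ := by simp
    exact le_of_mul_le_mul_left h6 (by exact_mod_cast hm)
  have h5 : ‖x.1.1‖ ≤ δ + c₁ * (S * δ) := by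
    have h6 : ‖Lp.const 2 (volume.restrict Ω) a‖ ≤ c₁ * ‖a‖ := hc₁ a
    have h7 := norm_le_norm_sub_add x.1.1 (Lp.const 2 (volume.restrict Ω) a)
    have h8 : c₁ * ‖a‖ ≤ c₁ * (S * δ) := by gcongr
    linarith
  have h6 : ‖x.1.2.2‖ ≤ δ + c₂ * (S * δ) := by
    have h6 : ‖Lp.const 2 (surfaceMeasure Ω) a‖ ≤ c₂ * ‖a‖ := hc₂ a
    have h7 := norm_le_norm_sub_add x.1.2.2 (Lp.const 2 (surfaceMeasure Ω) a)
    have h8 : c₂ * ‖a‖ ≤ c₂ * (S * δ) := by gcongr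
    linarith
  have h7 : ‖x.2‖ ≤ 2 * (S * δ) := by
    refine (pi_norm_le_iff_of_nonneg (by positivity)).2 fun l => ?_
    have := norm_le_norm_sub_add (x.2 l) a
    linarith [h3 l]
  have hG0 := norm_nonneg x.1.2.1
  have hb1 : 0 ≤ c₁ * (S * δ) := by positivity
  have hb2 : 0 ≤ c₂ * (S * δ) := by positivity
  have hb3 : 0 ≤ S * δ := by positivity
  have hKδ : K * δ = δ + c₁ * (S * δ) + c₂ * (S * δ) + 2 * (S * δ) := by rw [hK]; ring
  have hfin : K * (1 + C) * ε + (K * C + 1) * ‖x.1.2.1‖ = K * δ + ‖x.1.2.1‖ := by rw [hδ]; ring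
  rw [hfin]
  rw [Prod.norm_def, Prod.norm_def, Prod.norm_def]
  refine max_le (max_le ?_ (max_le ?_ ?_)) ?_ <;> linarith

end Coercive

/-! ### Lax-Milgram. -/

section LaxMilgram

variable {H : Type*} [NormedAddCommGroup H] [InnerProductSpace ℂ H] [CompleteSpace H]

/-- Coercivity bounds `T` from below, so its range is closed; a vector `w` orthogonal to the range
has `⟪w, T w⟫ = 0` and hence vanishes. -/
theorem surjective_of_coercive {T : H →L[ℂ] H} {κ : ℝ} (hκ : 0 < κ)
    (hT : ∀ h, κ * ‖h‖ ^ 2 ≤ (inner ℂ h (T h) : ℂ).re) : Function.Surjective T := by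
  have hb : ∀ h, κ * ‖h‖ ≤ ‖T h‖ := fun h => by
    rcases eq_or_ne h 0 with rfl | h0
    · simp
    have h1 : κ * ‖h‖ ^ 2 ≤ ‖h‖ * ‖T h‖ :=
      (hT h).trans ((Complex.re_le_norm _).trans (norm_inner_le_norm _ _))
    have h2 : 0 < ‖h‖ := norm_pos_iff.2 h0
    nlinarith
  have hanti : AntilipschitzWith (κ⁻¹.toNNReal) T := by
    refine ContinuousLinearMap.antilipschitz_of_bound T fun h => ?_
    rw [Real.coe_toNNReal _ (inv_pos.2 hκ).le, ← div_eq_inv_mul, le_div_iff₀ hκ, mul_comm]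
    exact hb h
  have hcl : IsClosed (T.range : Set H) := hanti.isClosed_range T.uniformContinuous
  have hcomp : CompleteSpace T.range := hcl.completeSpace_coe
  have htop : T.range = ⊤ := by
    rw [← T.range.orthogonal_orthogonal, Submodule.eq_top_iff']
    intro v w hw
    have h0 : (inner ℂ (T w) w : ℂ) = 0 := hw (T w) ⟨w, rfl⟩
    have h1 : (inner ℂ w (T w) : ℂ) = 0 := by
      rw [← inner_conj_symm, h0, map_zero]
    have h2 := hT w
    rw [h1, Complex.zero_re] at h2
    have h3 : ‖w‖ = 0 := by
      by_contra h
      have : 0 < ‖w‖ := lt_of_le_of_ne (norm_nonneg _) (Ne.symm h)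
      have : 0 < κ * ‖w‖ ^ 2 := by positivity
      linarith
    rw [norm_eq_zero.1 h3, inner_zero_left]
  exact LinearMap.range_eq_top.1 htop

/-- A version of the Lax-Milgram theorem, on a space which is embedded into a Hilbert space. -/
theorem exists_forall_inner_eq_of_coercive {X : Type*} [NormedAddCommGroup X] [NormedSpace ℂ X]
    [CompleteSpace X] (p : X →L[ℂ] H) {C : ℝ} (hp : ∀ x, ‖x‖ ≤ C * ‖p x‖)
    {M : H →L[ℂ] H} {κ : ℝ} (hκ : 0 < κ)
    (hM : ∀ h, κ * ‖h‖ ^ 2 ≤ (inner ℂ h (M h) : ℂ).re) (l : X →L[ℂ] ℂ) :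
    ∃ x, ∀ y, inner ℂ (p y) (M (p x)) = (starRingEnd ℂ) (l y) := by
  have hanti : AntilipschitzWith C.toNNReal p :=
    ContinuousLinearMap.antilipschitz_of_bound p fun x =>
      (hp x).trans (by gcongr; exact Real.le_coe_toNNReal C)
  -- `X` carries no inner product, but `p` is bounded below, so `X` is isomorphic to a closed
  -- subspace of `H`, on which the compression of `M` is coercive.
  have hcl : IsClosed (Set.range p) := hanti.isClosed_range p.uniformContinuous
  have hcomp : CompleteSpace p.range := (show IsClosed (p.range : Set H) from hcl).completeSpace_coe
  obtain ⟨e, he⟩ : ∃ e : X ≃L[ℂ] p.range, ∀ x, (e x : H) = p x :=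
    ⟨p.equivRange hanti.injective hcl, fun x => rfl⟩
  obtain ⟨T, hT⟩ : ∃ T : p.range →L[ℂ] p.range, ∀ s t : p.range,
      inner ℂ s (T t) = inner ℂ (s : H) (M t) := by
    refine ⟨p.range.orthogonalProjectionOnto ∘L M ∘L p.range.subtypeL, fun s t => ?_⟩
    simp
  have hsurj := surjective_of_coercive (T := T) hκ fun s => by
    rw [hT]; exact hM s
  obtain ⟨s, hs⟩ := hsurj ((InnerProductSpace.toDual ℂ p.range).symm (l ∘L (e.symm : p.range →L[ℂ] X)))
  refine ⟨e.symm s, fun y => ?_⟩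
  have h1 : p (e.symm s) = s := by rw [← he, e.apply_symm_apply]
  have h2 := hT (e y) s
  rw [hs, ← inner_conj_symm, InnerProductSpace.toDual_symm_apply] at h2
  rw [h1, ← he, ← h2]
  simp

end LaxMilgram

/-! ### The sesquilinear form of an admittivity. -/

section Form

variable {n : ℕ} {Ω : Set (EuclideanSpace ℝ (Fin n))}

theorem mul_sum_mul_conj_eq_inner (c : ℂ) (a b : EuclideanSpace ℂ (Fin n)) :
    c * ∑ i, a i * (starRingEnd ℂ) (b i) = inner ℂ b (c • a) := by
  simp [PiLp.inner_apply, Finset.mul_sum]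

/-- Multiplication by an admittivity, as a coercive operator on `L²(Ω)ⁿ`. -/
theorem IsAdmittivity.exists_mulOperator {γ : EuclideanSpace ℝ (Fin n) → ℂ}
    (hγ : IsAdmittivity Ω γ) :
    ∃ M : Lp (EuclideanSpace ℂ (Fin n)) 2 (volume.restrict Ω) →L[ℂ]
        Lp (EuclideanSpace ℂ (Fin n)) 2 (volume.restrict Ω),
      (∀ G, M G =ᵐ[volume.restrict Ω] fun x => γ x • G x) ∧
      ∃ κ : ℝ, 0 < κ ∧ ∀ G, κ * ‖G‖ ^ 2 ≤ (inner ℂ G (M G) : ℂ).re := by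
  obtain ⟨hm, ⟨C, hC⟩, κ, hκ, hκγ⟩ := hγ
  have hL : MemLp γ ⊤ (volume.restrict Ω) := memLp_top_of_bound hm C hC
  obtain ⟨M, hM⟩ : ∃ M : Lp (EuclideanSpace ℂ (Fin n)) 2 (volume.restrict Ω) →L[ℂ]
        Lp (EuclideanSpace ℂ (Fin n)) 2 (volume.restrict Ω),
      ∀ G, M G =ᵐ[volume.restrict Ω] fun x => γ x • G x := by
    refine ⟨(ContinuousLinearMap.lsmul ℂ ℂ).holderL (volume.restrict Ω) ⊤ 2 2 (hL.toLp γ),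
      fun G => ?_⟩
    have h1 := (ContinuousLinearMap.lsmul ℂ ℂ : ℂ →L[ℂ] EuclideanSpace ℂ (Fin n) →L[ℂ]
      EuclideanSpace ℂ (Fin n)).coeFn_holder (r := 2) (hL.toLp γ) G
    filter_upwards [h1, hL.coeFn_toLp] with x hx hx2
    rw [ContinuousLinearMap.holderL_apply_apply, hx, hx2]
    rfl
  refine ⟨M, hM, κ, hκ, fun G => ?_⟩
  have i1 := L2.integrable_inner (𝕜 := ℂ) G (M G)
  have i2 := L2.integrable_inner (𝕜 := ℂ) G G
  have h1 : (inner ℂ G (M G) : ℂ).re = ∫ x in Ω, (inner ℂ (G x) (M G x) : ℂ).re := by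
    rw [L2.inner_def]
    exact (integral_re i1).symm
  have h2 : ‖G‖ ^ 2 = ∫ x in Ω, (inner ℂ (G x) (G x) : ℂ).re := by
    rw [← inner_self_eq_norm_sq (𝕜 := ℂ), L2.inner_def]
    exact (integral_re i2).symm
  have i3 : Integrable (fun x => (inner ℂ (G x) (M G x) : ℂ).re) (volume.restrict Ω) := i1.re
  have i4 : Integrable (fun x => (inner ℂ (G x) (G x) : ℂ).re) (volume.restrict Ω) := i2.re
  rw [h1, h2, ← integral_const_mul]
  refine integral_mono_ae (i4.const_mul κ) i3 ?_
  filter_upwards [hM G, hκγ] with x hx hx2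
  have h3 : (inner ℂ (G x) (G x) : ℂ) = ((‖G x‖ ^ 2 : ℝ) : ℂ) := by
    simp [inner_self_eq_norm_sq_to_K]
  rw [hx, inner_smul_right, h3, Complex.re_mul_ofReal, Complex.ofReal_re]
  gcongr

theorem integral_form_eq_inner {γ : EuclideanSpace ℝ (Fin n) → ℂ}
    {M : Lp (EuclideanSpace ℂ (Fin n)) 2 (volume.restrict Ω) →L[ℂ]
        Lp (EuclideanSpace ℂ (Fin n)) 2 (volume.restrict Ω)}
    (hM : ∀ G, M G =ᵐ[volume.restrict Ω] fun x => γ x • G x)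
    (G H : Lp (EuclideanSpace ℂ (Fin n)) 2 (volume.restrict Ω)) :
    ∫ x in Ω, γ x * ∑ i, G x i * (starRingEnd ℂ) (H x i) = inner ℂ H (M G) := by
  rw [L2.inner_def]
  refine integral_congr_ae ?_
  filter_upwards [hM G] with x hx
  rw [hx, mul_sum_mul_conj_eq_inner]

theorem integrable_form {γ : EuclideanSpace ℝ (Fin n) → ℂ} (hγ : IsAdmittivity Ω γ)
    (G H : Lp (EuclideanSpace ℂ (Fin n)) 2 (volume.restrict Ω)) :
    Integrable (fun x => γ x * ∑ i, G x i * (starRingEnd ℂ) (H x i)) (volume.restrict Ω) := by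
  obtain ⟨M, hM, -⟩ := hγ.exists_mulOperator
  refine (L2.integrable_inner (𝕜 := ℂ) H (M G)).congr ?_
  filter_upwards [hM G] with x hx
  rw [hx, mul_sum_mul_conj_eq_inner]

end Form

/-! ### The variational problem and its linearity. -/

section GroundedSolution

variable {n m : ℕ} (Ω : Set (EuclideanSpace ℝ (Fin n))) (E : Fin m → Set (EuclideanSpace ℝ (Fin n)))

/-- The shunt model, as a variational problem on `groundedSpace`. -/
def IsGroundedSolution (γ : EuclideanSpace ℝ (Fin n) → ℂ) (I : Fin m → ℂ)
    (x : GraphSpace Ω × (Fin m → ℂ)) : Prop :=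
  x ∈ groundedSpace Ω E ∧ ∀ y ∈ groundedSpace Ω E,
    ∫ z in Ω, γ z * ∑ i, x.1.2.1 z i * (starRingEnd ℂ) (y.1.2.1 z i) =
      ∑ l, I l * (starRingEnd ℂ) (y.2 l)

variable {Ω E} {γ : EuclideanSpace ℝ (Fin n) → ℂ} {I : Fin m → ℂ}

theorem isGroundedSolution_iff {M : Lp (EuclideanSpace ℂ (Fin n)) 2 (volume.restrict Ω) →L[ℂ]
        Lp (EuclideanSpace ℂ (Fin n)) 2 (volume.restrict Ω)}
    (hM : ∀ G, M G =ᵐ[volume.restrict Ω] fun x => γ x • G x) {x : GraphSpace Ω × (Fin m → ℂ)} :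
    IsGroundedSolution Ω E γ I x ↔ x ∈ groundedSpace Ω E ∧ ∀ y ∈ groundedSpace Ω E,
      inner ℂ y.1.2.1 (M x.1.2.1) = ∑ l, I l * (starRingEnd ℂ) (y.2 l) := by
  simp only [IsGroundedSolution, integral_form_eq_inner hM]

theorem IsGroundedSolution.sum_smul (hγ : IsAdmittivity Ω γ) {ι : Type*} {s : Finset ι}
    {J : ι → Fin m → ℂ} {x : ι → GraphSpace Ω × (Fin m → ℂ)}
    (h : ∀ r ∈ s, IsGroundedSolution Ω E γ (J r) (x r)) (a : ι → ℂ) :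
    IsGroundedSolution Ω E γ (∑ r ∈ s, a r • J r) (∑ r ∈ s, a r • x r) := by
  obtain ⟨M, hM, -⟩ := hγ.exists_mulOperator
  simp only [isGroundedSolution_iff hM] at h ⊢
  refine ⟨Submodule.sum_mem _ fun r hr => Submodule.smul_mem _ _ (h r hr).1, fun y hy => ?_⟩
  have h1 : (∑ r ∈ s, a r • x r).1.2.1 = ∑ r ∈ s, a r • (x r).1.2.1 := by
    simp [Prod.fst_sum, Prod.snd_sum]
  rw [h1, map_sum, inner_sum]
  simp only [map_smul, inner_smul_right, Finset.sum_apply, Pi.smul_apply, smul_eq_mul,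
    Finset.sum_mul]
  rw [Finset.sum_comm]
  refine Finset.sum_congr rfl fun r hr => ?_
  rw [(h r hr).2 y hy, Finset.mul_sum]
  exact Finset.sum_congr rfl fun l _ => by ring

/-- The flux `γ ∇u` is unchanged. This is the source of `α R(γ) = R(γ / α)`. -/
theorem IsGroundedSolution.div_smul {α : ℂ} (hα : α ≠ 0) {x : GraphSpace Ω × (Fin m → ℂ)}
    (h : IsGroundedSolution Ω E γ I x) :
    IsGroundedSolution Ω E (fun z => γ z / α) I (α • x) := by
  refine ⟨Submodule.smul_mem _ _ h.1, fun y hy => ?_⟩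
  rw [← h.2 y hy]
  refine integral_congr_ae ?_
  filter_upwards [Lp.coeFn_smul α x.1.2.1] with z hz
  have hz' : (α • x).1.2.1 z = α • x.1.2.1 z := hz
  simp only [hz', PiLp.smul_apply, smul_eq_mul, mul_assoc]
  rw [← Finset.mul_sum]
  field_simp

end GroundedSolution

/-! ### Existence and uniqueness for the shunt model. -/

section WellPosed

variable {k m : ℕ} {Ω : Set (EuclideanSpace ℝ (Fin (k + 1)))}
  {E : Fin m → Set (EuclideanSpace ℝ (Fin (k + 1)))} {γ : EuclideanSpace ℝ (Fin (k + 1)) → ℂ}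
  {I : Fin m → ℂ}

theorem exists_isGroundedSolution (hΩ : IsLipschitzDomain Ω) (hm : 0 < m)
    (hEpos : ∀ l, 0 < surfaceMeasure Ω (E l)) (hγ : IsAdmittivity Ω γ) (I : Fin m → ℂ) :
    ∃ x, IsGroundedSolution Ω E γ I x := by
  have hfin := hΩ.isFiniteMeasure_surfaceMeasure
  obtain ⟨M, hM, κ, hκ, hco⟩ := hγ.exists_mulOperator
  obtain ⟨C, -, hC⟩ := hΩ.exists_norm_le_norm_grad hm hEpos
  have hX : CompleteSpace (groundedSpace Ω E) := isClosed_groundedSpace.completeSpace_coe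
  -- The embedding sends a grounded function to its gradient; it is bounded below by the Poincaré
  -- estimate.
  obtain ⟨x, hx⟩ := exists_forall_inner_eq_of_coercive
    (ContinuousLinearMap.fst ℂ _ _ ∘L ContinuousLinearMap.snd ℂ _ _ ∘L
      ContinuousLinearMap.fst ℂ _ _ ∘L (groundedSpace Ω E).subtypeL) (fun x => hC x x.2) hκ hco
    (∑ l, (starRingEnd ℂ) (I l) • (ContinuousLinearMap.proj l ∘L
      ContinuousLinearMap.snd ℂ _ _ ∘L (groundedSpace Ω E).subtypeL))
  refine ⟨x, (isGroundedSolution_iff hM).2 ⟨x.2, fun y hy => (hx ⟨y, hy⟩).trans ?_⟩⟩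
  simp

theorem IsGroundedSolution.unique (hΩ : IsLipschitzDomain Ω) (hm : 0 < m)
    (hEpos : ∀ l, 0 < surfaceMeasure Ω (E l)) (hγ : IsAdmittivity Ω γ)
    {x x' : GraphSpace Ω × (Fin m → ℂ)} (h : IsGroundedSolution Ω E γ I x)
    (h' : IsGroundedSolution Ω E γ I x') : x = x' := by
  obtain ⟨M, hM, κ, hκ, hco⟩ := hγ.exists_mulOperator
  obtain ⟨C, hC0, hC⟩ := hΩ.exists_norm_le_norm_grad hm hEpos
  rw [isGroundedSolution_iff hM] at h h'
  have hd : x - x' ∈ groundedSpace Ω E := Submodule.sub_mem _ h.1 h'.1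
  have h1 : inner ℂ (x - x').1.2.1 (M (x - x').1.2.1) = 0 := by
    have h2 : (x - x').1.2.1 = x.1.2.1 - x'.1.2.1 := rfl
    nth_rw 2 [h2]
    rw [map_sub, inner_sub_right, h.2 _ hd, h'.2 _ hd, sub_self]
  have h3 := hco (x - x').1.2.1
  rw [h1, Complex.zero_re] at h3
  have h4 : ‖(x - x').1.2.1‖ = 0 := by
    by_contra h
    have : 0 < ‖(x - x').1.2.1‖ := lt_of_le_of_ne (norm_nonneg _) (Ne.symm h)
    have : 0 < κ * ‖(x - x').1.2.1‖ ^ 2 := by positivity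
    linarith
  have h5 := hC _ hd
  rw [h4, mul_zero] at h5
  exact sub_eq_zero.1 (norm_le_zero_iff.1 h5)

/-- Test functions of the shunt model need not be grounded. Subtracting the mean of their electrode
values changes neither the gradient nor, as the currents sum to zero, the right-hand side. -/
theorem IsGroundedSolution.isShuntSolution (hΩ : IsLipschitzDomain Ω) (hm : 0 < m)
    (hI : ∑ l, I l = 0) {x : GraphSpace Ω × (Fin m → ℂ)} (h : IsGroundedSolution Ω E γ I x) :
    IsShuntSolution Ω E γ I x.1.1 x.2 := by
  have hfin := hΩ.isFiniteMeasure_surfaceMeasure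
  have hfin' := hΩ.isFiniteMeasure_volume
  obtain ⟨h1, h2⟩ := mem_groundedSpace.1 h.1
  refine ⟨x.1.2.1, memH1Electrode_of_mem hΩ.1 hΩ.2.2.1 h1, h2, fun v H V hV => ?_⟩
  obtain ⟨p, hp, -, hpH⟩ := hV.exists_mem_electrodeSpace hΩ.1 hΩ.2.2.1
  obtain ⟨a, ha⟩ : ∃ a : ℂ, a = (∑ l, V l) / m := ⟨_, rfl⟩
  have hy := Submodule.sub_mem _ hp (const_mem_electrodeSpace a)
  have hm' : (m : ℂ) ≠ 0 := Nat.cast_ne_zero.2 hm.ne'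
  have h3 := h.2 _ (mem_groundedSpace.2 ⟨hy, by simp [ha]; field_simp; simp⟩)
  have h4 : ∑ l, I l * (starRingEnd ℂ) (V l - a) = ∑ l, I l * (starRingEnd ℂ) (V l) := by
    simp only [map_sub, mul_sub, Finset.sum_sub_distrib, ← Finset.sum_mul, hI, zero_mul, sub_zero]
  rw [← h4]
  refine Eq.trans (integral_congr_ae ?_) h3
  filter_upwards [hpH] with z hz
  have h5 : ((p, V) - ((Lp.const 2 (volume.restrict Ω) a, 0,
      Lp.const 2 (surfaceMeasure Ω) a), fun _ => a) : GraphSpace Ω × (Fin m → ℂ)).1.2.1 = p.2.1 :=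
    sub_zero _
  rw [h5, hz]

theorem IsShuntSolution.exists_isGroundedSolution (hΩ : IsLipschitzDomain Ω)
    {u : EuclideanSpace ℝ (Fin (k + 1)) → ℂ} {U : Fin m → ℂ} (h : IsShuntSolution Ω E γ I u U) :
    ∃ x, IsGroundedSolution Ω E γ I x ∧ x.1.1 =ᵐ[volume.restrict Ω] u ∧ x.2 = U := by
  have hfin := hΩ.isFiniteMeasure_surfaceMeasure
  obtain ⟨G, hG, hU, h⟩ := h
  obtain ⟨p, hp, hpu, hpG⟩ := hG.exists_mem_electrodeSpace hΩ.1 hΩ.2.2.1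
  refine ⟨(p, U), ⟨mem_groundedSpace.2 ⟨hp, hU⟩, fun y hy => ?_⟩, hpu, rfl⟩
  rw [← h _ _ _ (memH1Electrode_of_mem hΩ.1 hΩ.2.2.1 (mem_groundedSpace.1 hy).1)]
  refine integral_congr_ae ?_
  filter_upwards [hpG] with z hz
  rw [hz]

theorem shuntWellPosed (hΩ : IsLipschitzDomain Ω) (hm : 0 < m)
    (hEpos : ∀ l, 0 < surfaceMeasure Ω (E l)) (hγ : IsAdmittivity Ω γ) (hI : ∑ l, I l = 0) :
    ShuntWellPosed Ω E γ I := by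
  obtain ⟨x, hx⟩ := exists_isGroundedSolution hΩ hm hEpos hγ I
  refine ⟨x.1.1, x.2, hx.isShuntSolution hΩ hm hI, fun u' U' h' => ?_⟩
  obtain ⟨x', hx', hu', rfl⟩ := h'.exists_isGroundedSolution hΩ
  obtain rfl := hx.unique hΩ hm hEpos hγ hx'
  exact ⟨hu'.symm, rfl⟩

theorem IsGroundedSolution.electrodeVoltages_eq (hΩ : IsLipschitzDomain Ω) (hm : 0 < m)
    (hEpos : ∀ l, 0 < surfaceMeasure Ω (E l)) (hγ : IsAdmittivity Ω γ) (hI : ∑ l, I l = 0)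
    {x : GraphSpace Ω × (Fin m → ℂ)} (hx : IsGroundedSolution Ω E γ I x) :
    electrodeVoltages Ω E γ I = x.2 := by
  have h : ∃ (U : Fin m → ℂ) (u : EuclideanSpace ℝ (Fin (k + 1)) → ℂ),
    IsShuntSolution Ω E γ I u U := ⟨_, _, hx.isShuntSolution hΩ hm hI⟩
  rw [electrodeVoltages, dif_pos h]
  obtain ⟨u, hu⟩ := h.choose_spec
  obtain ⟨x', hx', -, h'⟩ := hu.exists_isGroundedSolution hΩ
  rw [← h', hx.unique hΩ hm hEpos hγ hx']

theorem sum_dipole (a b : Fin m) : ∑ l, dipole a b l = 0 := by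
  simp [dipole]

theorem sum_dipole_mul (a b : Fin m) (U : Fin m → ℂ) : ∑ l, dipole a b l * U l = U a - U b := by
  simp [dipole, sub_mul, Finset.sum_sub_distrib]

theorem conj_dipole (a b l : Fin m) : (starRingEnd ℂ) (dipole a b l) = dipole a b l := by
  simp only [dipole, map_sub]
  split_ifs <;> simp

end WellPosed

/-! ### Comparison of powers. -/

section Comparison

variable {n m : ℕ} {Ω : Set (EuclideanSpace ℝ (Fin n))} {E : Fin m → Set (EuclideanSpace ℝ (Fin n))}

/-- `2 g |a| |b| ≤ g |b|² + g |a|²`, and `g ≤ Re γ` in the last term. -/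
theorem two_mul_re_le_of_le_re {γ : ℂ} {g : ℝ} (hg : 0 ≤ g) (h : g ≤ γ.re)
    (a b : EuclideanSpace ℂ (Fin n)) :
    2 * ((g : ℂ) * ∑ i, b i * (starRingEnd ℂ) (a i)).re ≤
      ((g : ℂ) * ∑ i, b i * (starRingEnd ℂ) (b i)).re +
        (γ * ∑ i, a i * (starRingEnd ℂ) (a i)).re := by
  have e1 := mul_sum_mul_conj_eq_inner 1 b a
  have e2 : ∀ b : EuclideanSpace ℂ (Fin n), ∑ i, b i * (starRingEnd ℂ) (b i) = ((‖b‖ ^ 2 : ℝ) : ℂ) :=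
    fun b => by
      have := mul_sum_mul_conj_eq_inner 1 b b
      rw [one_mul, one_smul] at this
      rw [this, inner_self_eq_norm_sq_to_K]
      simp
  rw [one_mul, one_smul] at e1
  rw [e1, e2, e2, Complex.re_mul_ofReal, Complex.re_ofReal_mul, Complex.re_mul_ofReal,
    Complex.ofReal_re]
  have h1 : (inner ℂ a b : ℂ).re ≤ ‖a‖ * ‖b‖ := (Complex.re_le_norm _).trans (norm_inner_le_norm _ _)
  have h2 := mul_le_mul_of_nonneg_left h1 hg
  have h3 := mul_le_mul_of_nonneg_right h (sq_nonneg ‖a‖)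
  nlinarith [mul_nonneg hg (sq_nonneg (‖a‖ - ‖b‖))]

/-- Arithmetic-geometric mean: `|γ| ≤ √(g Re γ)` bounds the left side by `2 √(g |b|² · Re γ |a|²)`.
-/
theorem two_mul_re_le_of_norm_sq_le {γ : ℂ} {g : ℝ} (hg : 0 ≤ g) (hγ : 0 ≤ γ.re)
    (h : ‖γ‖ ^ 2 ≤ g * γ.re) (a b : EuclideanSpace ℂ (Fin n)) :
    2 * (γ * ∑ i, a i * (starRingEnd ℂ) (b i)).re ≤
      ((g : ℂ) * ∑ i, b i * (starRingEnd ℂ) (b i)).re +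
        (γ * ∑ i, a i * (starRingEnd ℂ) (a i)).re := by
  have e1 := mul_sum_mul_conj_eq_inner 1 a b
  have e2 : ∀ b : EuclideanSpace ℂ (Fin n), ∑ i, b i * (starRingEnd ℂ) (b i) = ((‖b‖ ^ 2 : ℝ) : ℂ) :=
    fun b => by
      have := mul_sum_mul_conj_eq_inner 1 b b
      rw [one_mul, one_smul] at this
      rw [this, inner_self_eq_norm_sq_to_K]
      simp
  rw [one_mul, one_smul] at e1
  rw [e1, e2, e2, Complex.re_mul_ofReal, Complex.re_mul_ofReal, Complex.ofReal_re]
  have h1 : (γ * inner ℂ b a).re ≤ ‖γ‖ * (‖b‖ * ‖a‖) := by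
    refine (Complex.re_le_norm _).trans ?_
    rw [norm_mul]
    gcongr
    exact norm_inner_le_norm _ _
  refine (mul_le_mul_of_nonneg_left h1 zero_le_two).trans ?_
  refine le_of_sq_le_sq ?_ (by positivity)
  have h3 := mul_le_mul_of_nonneg_right h (sq_nonneg (‖a‖ * ‖b‖))
  nlinarith [sq_nonneg (g * ‖b‖ ^ 2 - γ.re * ‖a‖ ^ 2)]

/-- If the pointwise inequality between the forms holds, then so does the one between the powers. -/
theorem two_mul_re_integral_le {F₁ F₂ F₃ : EuclideanSpace ℝ (Fin n) → ℂ}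
    (h₁ : Integrable F₁ (volume.restrict Ω)) (h₂ : Integrable F₂ (volume.restrict Ω))
    (h₃ : Integrable F₃ (volume.restrict Ω))
    (h : ∀ᵐ z ∂(volume.restrict Ω), 2 * (F₁ z).re ≤ (F₂ z).re + (F₃ z).re) :
    2 * (∫ z in Ω, F₁ z).re ≤ (∫ z in Ω, F₂ z).re + (∫ z in Ω, F₃ z).re := by
  have i₁ : Integrable (fun z => (F₁ z).re) (volume.restrict Ω) := h₁.re
  have i₂ : Integrable (fun z => (F₂ z).re) (volume.restrict Ω) := h₂.re
  have i₃ : Integrable (fun z => (F₃ z).re) (volume.restrict Ω) := h₃.re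
  have e₁ : ∫ z in Ω, (F₁ z).re = (∫ z in Ω, F₁ z).re := integral_re h₁
  have e₂ : ∫ z in Ω, (F₂ z).re = (∫ z in Ω, F₂ z).re := integral_re h₂
  have e₃ : ∫ z in Ω, (F₃ z).re = (∫ z in Ω, F₃ z).re := integral_re h₃
  rw [← e₁, ← e₂, ← e₃, ← integral_const_mul, ← integral_add i₂ i₃]
  exact integral_mono_ae (i₁.const_mul 2) (i₂.add i₃) h

variable {γ : EuclideanSpace ℝ (Fin n) → ℂ} {g : EuclideanSpace ℝ (Fin n) → ℝ} {J : Fin m → ℂ}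
  {x y : GraphSpace Ω × (Fin m → ℂ)}

/-- The mixed form is the equation for `y` tested with `x`, so its value is the power of `x`; the
integrated inequality reads `2 P_x ≤ P_y + P_x`. -/
theorem IsGroundedSolution.re_power_le_of_le_re (hγ : IsAdmittivity Ω γ)
    (hg : IsAdmittivity Ω fun z => (g z : ℂ)) (hx : IsGroundedSolution Ω E γ J x)
    (hy : IsGroundedSolution Ω E (fun z => (g z : ℂ)) J y)
    (h : ∀ᵐ z ∂(volume.restrict Ω), g z ≤ (γ z).re) :
    (∑ l, J l * (starRingEnd ℂ) (x.2 l)).re ≤ (∑ l, J l * (starRingEnd ℂ) (y.2 l)).re := by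
  obtain ⟨κ, hκ, hκg⟩ := hg.2.2
  have h1 := two_mul_re_integral_le (integrable_form hg y.1.2.1 x.1.2.1)
    (integrable_form hg y.1.2.1 y.1.2.1) (integrable_form hγ x.1.2.1 x.1.2.1) (by
      filter_upwards [h, hκg] with z hz hz2
      exact two_mul_re_le_of_le_re (hκ.le.trans hz2) hz _ _)
  rw [hy.2 _ hx.1, hy.2 _ hy.1, hx.2 _ hx.1] at h1
  linarith

/-- Here the mixed form is the equation for `x` tested with `y`, whence `2 P_y ≤ P_y + P_x`. -/
theorem IsGroundedSolution.re_power_le_of_norm_sq_le (hγ : IsAdmittivity Ω γ)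
    (hg : IsAdmittivity Ω fun z => (g z : ℂ)) (hx : IsGroundedSolution Ω E γ J x)
    (hy : IsGroundedSolution Ω E (fun z => (g z : ℂ)) J y)
    (h : ∀ᵐ z ∂(volume.restrict Ω), ‖γ z‖ ^ 2 ≤ g z * (γ z).re) :
    (∑ l, J l * (starRingEnd ℂ) (y.2 l)).re ≤ (∑ l, J l * (starRingEnd ℂ) (x.2 l)).re := by
  obtain ⟨κ, hκ, hκg⟩ := hg.2.2
  obtain ⟨κ', hκ', hκγ⟩ := hγ.2.2
  have h1 := two_mul_re_integral_le (integrable_form hγ x.1.2.1 y.1.2.1)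
    (integrable_form hg y.1.2.1 y.1.2.1) (integrable_form hγ x.1.2.1 x.1.2.1) (by
      filter_upwards [h, hκg, hκγ] with z hz hz2 hz3
      exact two_mul_re_le_of_norm_sq_le (hκ.le.trans hz2) (hκ'.le.trans hz3) hz _ _)
  rw [hx.2 _ hy.1, hy.2 _ hy.1, hx.2 _ hx.1] at h1
  linarith

/-- Reciprocity: for a real coefficient the form is Hermitian, and each solution serves as test
function for the other. -/
theorem IsGroundedSolution.sum_mul_conj_comm {J' : Fin m → ℂ}
    (hx : IsGroundedSolution Ω E (fun z => (g z : ℂ)) J x)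
    (hy : IsGroundedSolution Ω E (fun z => (g z : ℂ)) J' y) :
    ∑ l, J l * (starRingEnd ℂ) (y.2 l) = (starRingEnd ℂ) (∑ l, J' l * (starRingEnd ℂ) (x.2 l)) := by
  rw [← hx.2 y hy.1, ← hy.2 x hx.1, ← integral_conj]
  refine integral_congr_ae (Eventually.of_forall fun z => ?_)
  simp [mul_comm]

end Comparison

/-! ### The admittivities in question. -/

section Admittivity

variable {n : ℕ} {Ω D B : Set (EuclideanSpace ℝ (Fin n))}

theorem isAdmittivity_twoPhase (hD : MeasurableSet D) {a b : ℂ} (ha : 0 < a.re) (hb : 0 < b.re) :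
    IsAdmittivity Ω (twoPhase D a b) := by
  refine ⟨(Measurable.ite hD measurable_const measurable_const).aestronglyMeasurable,
    ⟨max ‖a‖ ‖b‖, Eventually.of_forall fun z => ?_⟩, min a.re b.re, lt_min ha hb,
    Eventually.of_forall fun z => ?_⟩ <;>
  · simp only [twoPhase]
    split_ifs <;> simp

theorem isAdmittivity_modulated (hB : MeasurableSet B) {β : ℝ} (hβ : -1 < β)
    {γ : EuclideanSpace ℝ (Fin n) → ℂ} (hγ : IsAdmittivity Ω γ) :
    IsAdmittivity Ω (modulated β B γ) := by
  obtain ⟨h1, ⟨C, hC⟩, κ, hκ, hκγ⟩ := hγ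
  have hr : ∀ z, (1 + (β : ℂ) * B.indicator (fun _ => (1 : ℂ)) z) =
      ((1 + β * B.indicator (fun _ => (1 : ℝ)) z : ℝ) : ℂ) := fun z => by
    by_cases hz : z ∈ B <;> simp [hz]
  have hb : ∀ z, min 1 (1 + β) ≤ 1 + β * B.indicator (fun _ => (1 : ℝ)) z ∧
      |1 + β * B.indicator (fun _ => (1 : ℝ)) z| ≤ 1 + |β| := fun z => by
    by_cases hz : z ∈ B
    · simp only [hz, Set.indicator_of_mem, mul_one, min_le_iff, le_refl, or_true, true_and]
      exact (abs_add_le _ _).trans (by simp)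
    · simp [hz]
  have hβ' : 0 < min 1 (1 + β) := lt_min one_pos (by linarith)
  refine ⟨((measurable_const.add (measurable_const.mul
    (measurable_const.indicator hB))).aestronglyMeasurable).mul h1, ⟨(1 + |β|) * C, ?_⟩,
    min 1 (1 + β) * κ, by positivity, ?_⟩
  · filter_upwards [hC] with z hz
    rw [modulated, hr, norm_mul, Complex.norm_real, Real.norm_eq_abs]
    exact mul_le_mul (hb z).2 hz (norm_nonneg _) (by positivity)
  · filter_upwards [hκγ] with z hz
    rw [modulated, hr, Complex.re_ofReal_mul]
    exact mul_le_mul (hb z).1 hz hκ.le (hβ'.le.trans (hb z).1)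

theorem twoPhase_div (a b α : ℂ) :
    (fun z => twoPhase D a b z / α) = twoPhase D (a / α) (b / α) := by
  funext z
  simp only [twoPhase]
  split_ifs <;> rfl

open Classical in
theorem modulated_twoPhase_of_subset (h : B ⊆ D) (β a b : ℝ) :
    modulated β B (twoPhase D (a : ℂ) (b : ℂ)) = fun z =>
      ((if z ∈ D then (if z ∈ B then (1 + β) * a else a) else b : ℝ) : ℂ) := by
  funext z
  by_cases hz : z ∈ D
  · by_cases hz2 : z ∈ B <;> simp [modulated, twoPhase, hz, hz2]
  · have hz2 : z ∉ B := fun hb => hz (h hb)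
    simp [modulated, twoPhase, hz, hz2]

end Admittivity

/-! ### Quadratic forms of measurement matrices. -/

section Measurement

variable {k m N : ℕ} {Ω : Set (EuclideanSpace ℝ (Fin (k + 1)))}
  {E : Fin m → Set (EuclideanSpace ℝ (Fin (k + 1)))}
  {γ : EuclideanSpace ℝ (Fin (k + 1)) → ℂ} {g : EuclideanSpace ℝ (Fin (k + 1)) → ℝ}

/-- The superposition of dipole currents with (conjugated) coefficients `z`. -/
def dipoleSum (j k : Fin N → Fin m) (z : Fin N → ℂ) : Fin m → ℂ :=
  ∑ r, (starRingEnd ℂ) (z r) • dipole (j r) (k r)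

theorem exists_measurementMatrix_eq (hΩ : IsLipschitzDomain Ω)
    (hEpos : ∀ l, 0 < surfaceMeasure Ω (E l)) (hγ : IsAdmittivity Ω γ) (j k : Fin N → Fin m) :
    ∃ x : Fin N → GraphSpace Ω × (Fin m → ℂ),
      (∀ r, IsGroundedSolution Ω E γ (dipole (j r) (k r)) (x r)) ∧
      ∀ r s, measurementMatrix Ω E j k γ r s = ∑ l, dipole (j s) (k s) l * (x r).2 l := by
  have hm : ∀ r : Fin N, 0 < m := fun r => (Nat.zero_le _).trans_lt (j r).2
  choose x hx using fun r => exists_isGroundedSolution hΩ (hm r) hEpos hγ (dipole (j r) (k r))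
  refine ⟨x, hx, fun r s => ?_⟩
  rw [sum_dipole_mul, ← (hx r).electrodeVoltages_eq hΩ (hm r) hEpos hγ (sum_dipole _ _)]
  rfl

/-- The row index is the driving pair and meets `conj (z r)`, hence the conjugates in `dipoleSum`.
The measuring pairs are weighted by `z s`, which produces `conj J` because dipoles are real. -/
theorem exists_star_dotProduct_measurementMatrix (hΩ : IsLipschitzDomain Ω)
    (hEpos : ∀ l, 0 < surfaceMeasure Ω (E l)) (hγ : IsAdmittivity Ω γ) (j k : Fin N → Fin m)
    (z : Fin N → ℂ) : ∃ x, IsGroundedSolution Ω E γ (dipoleSum j k z) x ∧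
      star z ⬝ᵥ (measurementMatrix Ω E j k γ).mulVec z =
        (starRingEnd ℂ) (∑ l, dipoleSum j k z l * (starRingEnd ℂ) (x.2 l)) := by
  obtain ⟨x, hx, hR⟩ := exists_measurementMatrix_eq hΩ hEpos hγ j k
  refine ⟨_, IsGroundedSolution.sum_smul hγ (fun r _ => hx r) _, ?_⟩
  have h2 : (∑ r, (starRingEnd ℂ) (z r) • x r).2 = ∑ r, (starRingEnd ℂ) (z r) • (x r).2 := by
    simp [Prod.snd_sum]
  rw [h2]
  simp only [dotProduct, Matrix.mulVec, hR, dipoleSum, Finset.sum_apply, Pi.smul_apply, smul_eq_mul,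
    map_sum, map_mul, Complex.conj_conj, conj_dipole, Pi.star_apply, RCLike.star_def,
    Finset.sum_mul, Finset.mul_sum]
  calc _ = ∑ r, ∑ l, ∑ s, (starRingEnd ℂ) (z r) * (dipole (j s) (k s) l * (x r).2 l * z s) :=
        Finset.sum_congr rfl fun r _ => Finset.sum_comm
    _ = ∑ l, ∑ r, ∑ s, (starRingEnd ℂ) (z r) * (dipole (j s) (k s) l * (x r).2 l * z s) :=
        Finset.sum_comm
    _ = _ := Finset.sum_congr rfl fun l _ => by
        refine Finset.sum_congr rfl fun r _ => Finset.sum_congr rfl fun s _ => by ring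

theorem isHermitian_measurementMatrix (hΩ : IsLipschitzDomain Ω)
    (hEpos : ∀ l, 0 < surfaceMeasure Ω (E l)) (hg : IsAdmittivity Ω fun z => (g z : ℂ))
    (j k : Fin N → Fin m) : (measurementMatrix Ω E j k fun z => (g z : ℂ)).IsHermitian := by
  obtain ⟨x, hx, hR⟩ := exists_measurementMatrix_eq hΩ hEpos hg j k
  refine Matrix.IsHermitian.ext fun r s => ?_
  have h := (hx r).sum_mul_conj_comm (hx s)
  rw [hR, hR, RCLike.star_def]
  simp only [map_sum, map_mul, conj_dipole, Complex.conj_conj] at h ⊢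
  exact h

theorem selfAdjPart_isHermitian (A : Matrix (Fin N) (Fin N) ℂ) : (selfAdjPart A).IsHermitian := by
  refine Matrix.IsHermitian.ext fun r s => ?_
  simp [selfAdjPart, Matrix.conjTranspose_apply, add_comm]

/-- The adjoint has the conjugate quadratic form, so averaging the two keeps the real part. -/
theorem re_star_dotProduct_selfAdjPart (A : Matrix (Fin N) (Fin N) ℂ) (z : Fin N → ℂ) :
    (star z ⬝ᵥ (selfAdjPart A).mulVec z).re = (star z ⬝ᵥ A.mulVec z).re := by
  have h : star z ⬝ᵥ A.conjTranspose.mulVec z = star (star z ⬝ᵥ A.mulVec z) := by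
    rw [Matrix.star_dotProduct, Matrix.star_mulVec, Matrix.conjTranspose_conjTranspose,
      Matrix.dotProduct_mulVec]
  rw [selfAdjPart, Matrix.smul_mulVec, Matrix.add_mulVec, dotProduct_smul, dotProduct_add, h]
  simp
  ring

theorem posSemidef_sub_of_re_le {A B : Matrix (Fin N) (Fin N) ℂ} (hA : A.IsHermitian)
    (hB : B.IsHermitian) (h : ∀ z, (star z ⬝ᵥ B.mulVec z).re ≤ (star z ⬝ᵥ A.mulVec z).re) :
    (A - B).PosSemidef := by
  refine Matrix.PosSemidef.of_dotProduct_mulVec_nonneg (hA.sub hB) fun z => ?_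
  rw [Complex.nonneg_iff]
  refine ⟨?_, ((hA.sub hB).im_star_dotProduct_mulVec_self z).symm⟩
  rw [Matrix.sub_mulVec, dotProduct_sub, Complex.sub_re, sub_nonneg]
  exact h z

variable {α : ℂ}

theorem exists_re_star_dotProduct_eq (hΩ : IsLipschitzDomain Ω)
    (hEpos : ∀ l, 0 < surfaceMeasure Ω (E l)) (hγ : IsAdmittivity Ω γ) (hα : α ≠ 0)
    (j k : Fin N → Fin m) (z : Fin N → ℂ) :
    ∃ x, IsGroundedSolution Ω E (fun z => γ z / α) (dipoleSum j k z) x ∧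
      (star z ⬝ᵥ (selfAdjPart (α • measurementMatrix Ω E j k γ)).mulVec z).re =
        (∑ l, dipoleSum j k z l * (starRingEnd ℂ) (x.2 l)).re := by
  obtain ⟨x, hx, hR⟩ := exists_star_dotProduct_measurementMatrix hΩ hEpos hγ j k z
  refine ⟨_, hx.div_smul hα, ?_⟩
  rw [re_star_dotProduct_selfAdjPart, Matrix.smul_mulVec, dotProduct_smul, hR, smul_eq_mul,
    ← Complex.conj_re, map_mul, Complex.conj_conj, Finset.mul_sum]
  congr 1
  refine Finset.sum_congr rfl fun l _ => ?_
  simp only [Prod.smul_snd, Pi.smul_apply, smul_eq_mul, map_mul]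
  ring

theorem posSemidef_measurementMatrix_sub_of_le_re (hΩ : IsLipschitzDomain Ω)
    (hEpos : ∀ l, 0 < surfaceMeasure Ω (E l)) (hγ : IsAdmittivity Ω γ) (hα : α ≠ 0)
    (hγα : IsAdmittivity Ω fun z => γ z / α) (hg : IsAdmittivity Ω fun z => (g z : ℂ))
    (h : ∀ z, g z ≤ (γ z / α).re) (j k : Fin N → Fin m) :
    (measurementMatrix Ω E j k (fun z => (g z : ℂ)) -
      selfAdjPart (α • measurementMatrix Ω E j k γ)).PosSemidef := by
  refine posSemidef_sub_of_re_le (isHermitian_measurementMatrix hΩ hEpos hg j k)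
    (selfAdjPart_isHermitian _) fun z => ?_
  obtain ⟨x, hx, hxR⟩ := exists_re_star_dotProduct_eq hΩ hEpos hγ hα j k z
  obtain ⟨y, hy, hyR⟩ := exists_star_dotProduct_measurementMatrix hΩ hEpos hg j k z
  rw [hxR, hyR, Complex.conj_re]
  exact hx.re_power_le_of_le_re hγα hg hy (Eventually.of_forall h)

theorem posSemidef_sub_measurementMatrix_of_norm_sq_le (hΩ : IsLipschitzDomain Ω)
    (hEpos : ∀ l, 0 < surfaceMeasure Ω (E l)) (hγ : IsAdmittivity Ω γ) (hα : α ≠ 0)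
    (hγα : IsAdmittivity Ω fun z => γ z / α) (hg : IsAdmittivity Ω fun z => (g z : ℂ))
    (h : ∀ z, ‖γ z / α‖ ^ 2 ≤ g z * (γ z / α).re) (j k : Fin N → Fin m) :
    (selfAdjPart (α • measurementMatrix Ω E j k γ) -
      measurementMatrix Ω E j k (fun z => (g z : ℂ))).PosSemidef := by
  refine posSemidef_sub_of_re_le (selfAdjPart_isHermitian _)
    (isHermitian_measurementMatrix hΩ hEpos hg j k) fun z => ?_
  obtain ⟨x, hx, hxR⟩ := exists_re_star_dotProduct_eq hΩ hEpos hγ hα j k z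
  obtain ⟨y, hy, hyR⟩ := exists_star_dotProduct_measurementMatrix hΩ hEpos hg j k z
  rw [hxR, hyR, Complex.conj_re]
  exact hx.re_power_le_of_norm_sq_le hγα hg hy (Eventually.of_forall h)

end Measurement

/-! ### The contrast bounds. -/

section Contrast

variable {ω σΩ σD εΩ εD : ℝ}

theorem re_div_complex_conductivity (hσΩ : 0 < σΩ) :
    (((σD : ℂ) + Complex.I * ω * εD) / (1 + Complex.I * ω * (εΩ / σΩ))).re =
      σΩ * (σD * σΩ + ω ^ 2 * εD * εΩ) / (σΩ ^ 2 + ω ^ 2 * εΩ ^ 2) := by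
  have hS : 0 < σΩ ^ 2 + ω ^ 2 * εΩ ^ 2 := by positivity
  have h : (εΩ : ℂ) / σΩ = ((εΩ / σΩ : ℝ) : ℂ) := by push_cast; rfl
  rw [h, Complex.div_re, Complex.normSq_apply]
  simp
  field_simp

theorem norm_sq_div_complex_conductivity (hσΩ : 0 < σΩ) :
    ‖((σD : ℂ) + Complex.I * ω * εD) / (1 + Complex.I * ω * (εΩ / σΩ))‖ ^ 2 =
      σΩ ^ 2 * (σD ^ 2 + ω ^ 2 * εD ^ 2) / (σΩ ^ 2 + ω ^ 2 * εΩ ^ 2) := by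
  have hS : 0 < σΩ ^ 2 + ω ^ 2 * εΩ ^ 2 := by positivity
  have h : (εΩ : ℂ) / σΩ = ((εΩ / σΩ : ℝ) : ℂ) := by push_cast; rfl
  rw [h, ← Complex.normSq_eq_norm_sq, map_div₀, Complex.normSq_apply, Complex.normSq_apply]
  simp
  field_simp

/-- This explains the choice of `α`: the background `σΩ + iωεΩ` is `σΩ α`. -/
theorem div_one_add_eq_background (hσΩ : 0 < σΩ) (ω εΩ : ℝ) :
    (1 + Complex.I * ω * (εΩ / σΩ) : ℂ) ≠ 0 ∧
      ((σΩ : ℂ) + Complex.I * ω * εΩ) / (1 + Complex.I * ω * (εΩ / σΩ)) = σΩ := by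
  have h : (1 + Complex.I * ω * (εΩ / σΩ) : ℂ) ≠ 0 := fun h0 => by
    have h1 := congrArg Complex.re h0
    rw [show (εΩ : ℂ) / σΩ = ((εΩ / σΩ : ℝ) : ℂ) by push_cast; rfl] at h1
    simp at h1
  have hσ : (σΩ : ℂ) ≠ 0 := Complex.ofReal_ne_zero.2 hσΩ.ne'
  refine ⟨h, (div_eq_iff h).2 ?_⟩
  field_simp

/-- The real part of the scaled inclusion value exceeds `σD` by exactly `ω² c εΩ / (σΩ² + ω² εΩ²)`.
-/
theorem one_add_mul_le_of_le (hσΩ : 0 < σΩ) (hσD : 0 < σD) {c : ℝ} (hc : c = εD * σΩ - εΩ * σD)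
    (hc0 : 0 < c) {β : ℝ} (hβ : β ≤ ω ^ 2 * |c| * (εΩ / (σD * (σΩ ^ 2 + ω ^ 2 * εΩ ^ 2)))) :
    (1 + β) * σD ≤ σΩ * (σD * σΩ + ω ^ 2 * εD * εΩ) / (σΩ ^ 2 + ω ^ 2 * εΩ ^ 2) := by
  have hS : 0 < σΩ ^ 2 + ω ^ 2 * εΩ ^ 2 := by positivity
  rw [abs_of_pos hc0, mul_div_assoc', le_div_iff₀ (by positivity)] at hβ
  rw [le_div_iff₀ hS]
  subst hc
  linarith

/-- The left side is `|a|² / Re a` for the scaled inclusion value `a`; it falls short of `σD` by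
exactly `ω² |c| εD / (σDσΩ + ω² εDεΩ)`. -/
theorem le_one_sub_mul_of_le (hσΩ : 0 < σΩ) (hσD : 0 < σD) (hεΩ : 0 < εΩ) (hεD : 0 < εD) {c : ℝ}
    (hc : c = εD * σΩ - εΩ * σD) (hc0 : c < 0) {β : ℝ}
    (hβ : β ≤ ω ^ 2 * |c| * (εD / (σD * (σD * σΩ + ω ^ 2 * εD * εΩ)))) :
    σΩ * (σD ^ 2 + ω ^ 2 * εD ^ 2) / (σD * σΩ + ω ^ 2 * εD * εΩ) ≤ (1 - β) * σD := by
  have hP : 0 < σD * σΩ + ω ^ 2 * εD * εΩ := by positivity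
  rw [abs_of_neg hc0, mul_div_assoc', le_div_iff₀ (by positivity)] at hβ
  rw [div_le_iff₀ hP]
  subst hc
  linarith

end Contrast

end EIT

end

theorem mainTheorem2 {n m N : ℕ} (hn : 2 ≤ n)
    (Ω : Set (EuclideanSpace ℝ (Fin n))) (hΩ : EIT.IsLipschitzDomain Ω)
    -- electrodes
    (E : Fin m → Set (EuclideanSpace ℝ (Fin n)))
    (hE : ∀ l, E l ⊆ frontier Ω) (hEmeas : ∀ l, MeasurableSet (E l))
    (hEpos : ∀ l, 0 < EIT.surfaceMeasure Ω (E l))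
    (hEdisj : Pairwise fun l l' => Disjoint (E l) (E l'))
    -- electrode pairs used for driving currents and for measuring voltages
    (j k : Fin N → Fin m) (hjk : ∀ r, j r ≠ k r)
    -- inclusion
    (D : Set (EuclideanSpace ℝ (Fin n))) (hD : IsClosed D) (hDΩ : D ⊆ Ω)
    (hDc : IsConnected (Ω \ D))
    (ω σΩ σD εΩ εD : ℝ) (hω : 0 < ω) (hσΩ : 0 < σΩ) (hσD : 0 < σD) (hεΩ : 0 < εΩ) (hεD : 0 < εD)
    (c : ℝ) (hc : c = εD * σΩ - εΩ * σD)
    (γ₀ γω : EuclideanSpace ℝ (Fin n) → ℂ)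
    (hγ₀ : γ₀ = EIT.twoPhase D (σD : ℂ) (σΩ : ℂ))
    (hγω : γω = EIT.twoPhase D ((σD : ℂ) + Complex.I * ω * εD) ((σΩ : ℂ) + Complex.I * ω * εΩ))
    (α : ℂ) (hα : α = 1 + Complex.I * ω * (εΩ / σΩ)) :
    -- the measurement matrices are well-defined
    (∀ γ : EuclideanSpace ℝ (Fin n) → ℂ, EIT.IsAdmittivity Ω γ →
      ∀ r, EIT.ShuntWellPosed Ω E γ (EIT.dipole (j r) (k r))) ∧
    EIT.IsAdmittivity Ω γω ∧
    (0 < c → ∀ β : ℝ, 0 < β → β ≤ ω ^ 2 * |c| * (εΩ / (σD * (σΩ ^ 2 + ω ^ 2 * εΩ ^ 2))) →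
      ∀ B : Set (EuclideanSpace ℝ (Fin n)), IsOpen B → B ⊆ Ω →
        EIT.IsAdmittivity Ω (EIT.modulated β B γ₀) ∧
        (B ⊆ D →
          (EIT.measurementMatrix Ω E j k (EIT.modulated β B γ₀) -
            EIT.selfAdjPart (α • EIT.measurementMatrix Ω E j k γω)).PosSemidef)) ∧
    (c < 0 → ∀ β : ℝ, 0 < β → β ≤ ω ^ 2 * |c| * (εD / (σD * (σD * σΩ + ω ^ 2 * εD * εΩ))) →
      ∀ B : Set (EuclideanSpace ℝ (Fin n)), IsOpen B → B ⊆ Ω →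
        EIT.IsAdmittivity Ω (EIT.modulated (-β) B γ₀) ∧
        (B ⊆ D →
          (EIT.selfAdjPart (α • EIT.measurementMatrix Ω E j k γω) -
            EIT.measurementMatrix Ω E j k (EIT.modulated (-β) B γ₀)).PosSemidef)) := by
  obtain ⟨d, rfl⟩ : ∃ d, n = d + 1 := ⟨n - 1, by omega⟩
  subst hγ₀ hγω
  obtain ⟨hα0, hbg⟩ := EIT.div_one_add_eq_background hσΩ ω εΩ
  have hre := EIT.re_div_complex_conductivity (ω := ω) (σD := σD) (εΩ := εΩ) (εD := εD) hσΩ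
  have hno := EIT.norm_sq_div_complex_conductivity (ω := ω) (σD := σD) (εΩ := εΩ) (εD := εD) hσΩ
  rw [← hα] at hα0 hbg hre hno
  have hP : 0 < σD * σΩ + ω ^ 2 * εD * εΩ := by positivity
  have hS : 0 < σΩ ^ 2 + ω ^ 2 * εΩ ^ 2 := by positivity
  obtain ⟨a, ha⟩ : ∃ a : ℂ, a = ((σD : ℂ) + Complex.I * ω * εD) / α := ⟨_, rfl⟩
  rw [← ha] at hre hno
  have ha0 : 0 < a.re := by rw [hre]; positivity
  have hγω : EIT.IsAdmittivity Ω
      (EIT.twoPhase D ((σD : ℂ) + Complex.I * ω * εD) ((σΩ : ℂ) + Complex.I * ω * εΩ)) :=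
    EIT.isAdmittivity_twoPhase hD.measurableSet (by simpa) (by simpa)
  have hdiv : ∀ z, EIT.twoPhase D ((σD : ℂ) + Complex.I * ω * εD)
      ((σΩ : ℂ) + Complex.I * ω * εΩ) z / α = EIT.twoPhase D a σΩ z := fun z => by
    rw [ha, ← hbg, ← EIT.twoPhase_div, hbg]
  have hγα : EIT.IsAdmittivity Ω fun z => EIT.twoPhase D ((σD : ℂ) + Complex.I * ω * εD)
      ((σΩ : ℂ) + Complex.I * ω * εΩ) z / α := by
    rw [funext hdiv]
    exact EIT.isAdmittivity_twoPhase hD.measurableSet ha0 (by simpa)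
  have hγ₀ : EIT.IsAdmittivity Ω (EIT.twoPhase D (σD : ℂ) (σΩ : ℂ)) :=
    EIT.isAdmittivity_twoPhase hD.measurableSet (by simpa) (by simpa)
  refine ⟨fun γ hγ r => EIT.shuntWellPosed hΩ ((Nat.zero_le _).trans_lt (j r).2) hEpos hγ
    (EIT.sum_dipole _ _), hγω, fun hc0 β hβ0 hβ B hB _ => ?_, fun hc0 β hβ0 hβ B hB _ => ?_⟩
  · have hmod := EIT.isAdmittivity_modulated hB.measurableSet (by linarith : -1 < β) hγ₀
    refine ⟨hmod, fun hBD => ?_⟩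
    have hle := EIT.one_add_mul_le_of_le hσΩ hσD hc hc0 hβ
    rw [← hre] at hle
    rw [EIT.modulated_twoPhase_of_subset hBD] at hmod ⊢
    refine EIT.posSemidef_measurementMatrix_sub_of_le_re hΩ hEpos hγω hα0 hγα hmod (fun z => ?_) j k
    rw [hdiv, EIT.twoPhase]
    -- The cases are `B`, where the bound on `β` is used; `D \ B`, where `σD ≤ (1 + β) σD`; and the
    -- complement of `D`, where equality holds.
    split_ifs
    · exact hle
    · nlinarith
    · simp
  · have hle := EIT.le_one_sub_mul_of_le hσΩ hσD hεΩ hεD hc hc0 hβ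
    -- The bound on `β` already forces `β < 1`, since the quantity below `(1 - β) σD` is positive.
    have hβ1 : 0 < (1 - β) * σD := lt_of_lt_of_le (by positivity) hle
    have hmod := EIT.isAdmittivity_modulated hB.measurableSet
      (by nlinarith : -1 < -β) hγ₀
    refine ⟨hmod, fun hBD => ?_⟩
    have hle2 : ‖a‖ ^ 2 ≤ (1 - β) * σD * a.re := by
      refine Eq.trans_le ?_ (mul_le_mul_of_nonneg_right hle ha0.le)
      rw [hno, hre]
      field_simp
    rw [EIT.modulated_twoPhase_of_subset hBD] at hmod ⊢
    refine EIT.posSemidef_sub_measurementMatrix_of_norm_sq_le hΩ hEpos hγω hα0 hγα hmod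
      (fun z => ?_) j k
    rw [hdiv, EIT.twoPhase]
    split_ifs
    · exact hle2.trans_eq (by ring)
    · nlinarith [mul_pos (mul_pos hβ0 hσD) ha0]
    · simp [sq]
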